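/- Let $\mathcal K=L^2(\mathbb R^+)$, let $\mathcal G$ be a complex Hilbert space with a countably infinite orthonormal basis $(e_k)_{k\ge1}$, and let $\mathcal H=L^2(\mathbb R^+,\mathcal G)\cong\mathcal K\otimes\mathcal G$. Let $\Gamma(\mathcal H)=\mathbb C\Omega\oplus\bigoplus_{n\ge1}\mathcal H^{\circ n}$ be the symmetric Fock space (the multiple symmetric Fock space over $\mathcal K$), where $u_1\circ\cdots\circ u_n=\frac1{n!}\sum_{s\in S_n}u_{s(1)}\otimes\cdots\otimes u_{s(n)}$, and let $\mathcal F(\mathcal K)=\mathbb C\omega\oplus\bigoplus_{n\ge1}\mathcal K^{\otimes n}$ be the free Fock space with its free creation operators $a^*(f)\omega=f$, $a^*(f)(f_1\otimes\cdots\otimes f_n)=f\otimes f_1\otimes\cdots\otimes f_n$. For $r\ge1$ let $P^{(r)}$ be the second quantization of the orthogonal projection of $\mathcal H$ onto the closed span of the vectors $f\otimes e_k$ with $f\in\mathcal K$, $1\le k\le r-1$, and let $P^{(0)}=0$. Let $a^*(h)$ denote the boson creation operator, $a^*(h)(u_1\circ\cdots\circ u_n)=\sqrt{n+1}\,h\circ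 u_1\circ\cdots\circ u_n$. For every $f\in\mathcal K$ the series $$l^*(f)=\sum_{k=1}^{\infty}a^*(f\otimes e_k)\bigl(P^{(k)}-P^{(k-1)}\bigr)$$ converges strongly on the linear span of $\Omega$ and the vectors $(f_1\otimes e_{k_1})\circ\cdots\circ(f_n\otimes e_{k_n})$ and has a unique bounded extension to $\Gamma(\mathcal H)$, also denoted $l^*(f)$ (the extended free creation operator). Let $\mathcal C$ be the $C^*$-algebra of operators on $\Gamma(\mathcal H)$ generated by $1$ and all $l^*(f)$, $f\in\mathcal K$, and let $\pi$ be its identity representation on $\Gamma(\mathcal H)$. For $x\in\Gamma(\mathcal H)$ let $[\mathcal Cx]$ be the closed linear span of $\{Ax: A\in\mathcal C\}$, and let $\pi_x(A)=A|_{[\mathcal Cx]}$. Let $(d_i)_{i\ge1}$ be an orthonormal basis of $\mathcal K$, and let $\mathcal D$ be the set consisting of $\Omega$ and of the normalized vectors $x=\hat x/\|\hat x\|$ with $$\hat x=(d_{i_1}\otimes e_{k_1})\circ\cdots\circ(d_{i_n}\otimes e_{k_n}),\qquad n\ge1,\quad k_1\le\cdots\le k_n,\quad i_r\le i_{r+1}\text{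 whenever }k_r=k_{r+1},$$ such that $k_n\ne k_{n-1}+1$, where $k_0=0$. **Theorem.** There is a unique $*$-homomorphism $\rho$ from $\mathcal C$ to the bounded operators on $\mathcal F(\mathcal K)$ with $\rho(1)=1$ and $\rho(l^*(f))=a^*(f)$ for all $f\in\mathcal K$ (the free Fock space representation of $\mathcal C$). One has the orthogonal direct sum decomposition $$\Gamma(\mathcal H)=\bigoplus_{x\in\mathcal D}[\mathcal Cx],\qquad\text{according to which}\qquad \pi=\bigoplus_{x\in\mathcal D}\pi_x,$$ and for every $x\in\mathcal D$ there is a unitary $U_x:\mathcal F(\mathcal K)\to[\mathcal Cx]$ such that $\pi_x(A)U_x=U_x\rho(A)$ for all $A\in\mathcal C$; in particular $[\mathcal Cx]\cong\mathcal F(\mathcal K)$ and $\pi_x\cong\rho$. -/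

import Mathlib

namespace FilteredFock
noncomputable section

section TensorPower
open scoped ComplexOrder
variable (E : Type*) [NormedAddCommGroup E] [InnerProductSpace ℂ E] (n : ℕ)

/-- The algebraic tensor power `E ⊗ ⋯ ⊗ E` (`n` factors). It is a type of its own because
`PiTensorProduct` already carries the projective seminorm, whereas here it gets the Hilbert
space scalar product `⟪u₁ ⊗ ⋯ ⊗ uₙ, v₁ ⊗ ⋯ ⊗ vₙ⟫ = ∏ ⟪uᵢ, vᵢ⟫`. -/
def AlgTensorPower : Type _ := PiTensorProduct ℂ (fun _ : Fin n => E)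

instance : AddCommGroup (AlgTensorPower E n) :=
  inferInstanceAs (AddCommGroup (PiTensorProduct ℂ (fun _ : Fin n => E)))

instance : Module ℂ (AlgTensorPower E n) :=
  inferInstanceAs (Module ℂ (PiTensorProduct ℂ (fun _ : Fin n => E)))

variable {E n}

/-- The pure tensor `u₁ ⊗ ⋯ ⊗ uₙ` in the algebraic tensor power. -/
def algTprod : MultilinearMap ℂ (fun _ : Fin n => E) (AlgTensorPower E n) :=
  PiTensorProduct.tprod ℂ

/-- The linear map on the algebraic tensor power induced by a multilinear map. -/
def algLift {M : Type*} [AddCommGroup M] [Module ℂ M]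
    (φ : MultilinearMap ℂ (fun _ : Fin n => E) M) : AlgTensorPower E n →ₗ[ℂ] M :=
  PiTensorProduct.lift φ

@[simp] theorem algLift_algTprod {M : Type*} [AddCommGroup M] [Module ℂ M]
    (φ : MultilinearMap ℂ (fun _ : Fin n => E) M) (u : Fin n → E) :
    algLift φ (algTprod u) = φ u :=
  PiTensorProduct.lift.tprod u

theorem alg_induction {p : AlgTensorPower E n → Prop} (x : AlgTensorPower E n)
    (smul : ∀ (c : ℂ) (u : Fin n → E), p (c • algTprod u))
    (add : ∀ x y, p x → p y → p (x + y)) : p x :=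
  PiTensorProduct.induction_on x smul add

theorem alg_exists_sum (x : AlgTensorPower E n) :
    ∃ (N : ℕ) (c : Fin N → ℂ) (u : Fin N → Fin n → E), x = ∑ j, c j • algTprod (u j) := by
  have hx : x ∈ Submodule.span ℂ (Set.range (algTprod (E := E) (n := n))) := by
    have h : Submodule.span ℂ (Set.range (algTprod (E := E) (n := n))) = ⊤ :=
      PiTensorProduct.span_tprod_eq_top
    rw [h]; trivial
  obtain ⟨N, c, g, h⟩ := Submodule.mem_span_set'.1 hx
  choose u hu using fun j => (g j).2
  exact ⟨N, c, u, by simp [hu, h]⟩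

/-- The functional `x ↦ ⟪v₁ ⊗ ⋯ ⊗ vₙ, x⟫`. -/
def pureFunctional (v : Fin n → E) : AlgTensorPower E n →ₗ[ℂ] ℂ :=
  algLift ((MultilinearMap.mkPiAlgebra ℂ (Fin n) ℂ).compLinearMap fun i => innerₛₗ ℂ (v i))

theorem pureFunctional_algTprod (v u : Fin n → E) :
    pureFunctional v (algTprod u) = ∏ i, inner ℂ (v i) (u i) := by
  simp [pureFunctional]

theorem conj_pureFunctional (v u : Fin n → E) :
    star (pureFunctional v (algTprod u)) =
      (MultilinearMap.mkPiAlgebra ℂ (Fin n) ℂ).compLinearMap (fun i => innerₛₗ ℂ (u i)) v := by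
  simp [pureFunctional_algTprod]

/-- The map `y ↦ (x ↦ ⟪x, y⟫)`. -/
def algForm : AlgTensorPower E n →ₗ[ℂ] AlgTensorPower E n →ₗ⋆[ℂ] ℂ :=
  algLift
    { toFun := fun v => (starLinearEquiv ℂ (A := ℂ)).toLinearMap.comp (pureFunctional v)
      map_update_add' := by
        intro _ v i a b
        ext x
        induction x using alg_induction with
        | smul c u =>
          have h := fun w => conj_pureFunctional w u
          simp only [Complex.star_def] at h
          simp only [LinearMap.comp_apply, LinearMap.add_apply, map_smulₛₗ,
            LinearEquiv.coe_coe, starLinearEquiv_apply, Complex.star_def, h,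
            MultilinearMap.map_update_add, smul_add]
        | add x y hx hy => rw [map_add, hx, hy, map_add]
      map_update_smul' := by
        intro _ v i c a
        ext x
        induction x using alg_induction with
        | smul c' u =>
          have h := fun w => conj_pureFunctional w u
          simp only [Complex.star_def] at h
          simp only [LinearMap.comp_apply, LinearMap.smul_apply, map_smulₛₗ,
            LinearEquiv.coe_coe, starLinearEquiv_apply, Complex.star_def, h,
            MultilinearMap.map_update_smul]
        | add x y hx hy => rw [map_add, hx, hy, map_add] }

theorem algForm_algTprod (u v : Fin n → E) :
    algForm (algTprod v) (algTprod u) = ∏ i, inner ℂ (u i) (v i) := by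
  simp [algForm, pureFunctional_algTprod]

theorem algForm_sum {N M : ℕ} (c : Fin N → ℂ) (u : Fin N → Fin n → E)
    (c' : Fin M → ℂ) (u' : Fin M → Fin n → E) :
    algForm (∑ k, c' k • algTprod (u' k)) (∑ j, c j • algTprod (u j)) =
      ∑ j, ∑ k, star (c j) * (∏ i, inner ℂ (u j i) (u' k i)) * c' k := by
  simp only [map_sum, LinearMap.sum_apply, map_smul, map_smulₛₗ, LinearMap.smul_apply,
    algForm_algTprod, smul_eq_mul]
  refine Finset.sum_congr rfl fun j _ => ?_
  rw [Finset.mul_sum]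
  refine Finset.sum_congr rfl fun k _ => ?_
  simp; ring

theorem posSemidef_quad {N : ℕ} {M : Matrix (Fin N) (Fin N) ℂ} (hM : M.PosSemidef)
    (c : Fin N → ℂ) : 0 ≤ ∑ j, ∑ k, star (c j) * M j k * c k := by
  have h := hM.dotProduct_mulVec_nonneg c
  simpa [dotProduct, Matrix.mulVec, Finset.mul_sum, mul_assoc] using h

theorem posSemidef_gram_sub {F : Type*} [NormedAddCommGroup F] [InnerProductSpace ℂ F]
    (T : E →L[ℂ] F) {N : ℕ} (u : Fin N → E) :
    (Matrix.of fun j k => (‖T‖ : ℂ) ^ 2 * inner ℂ (u j) (u k) -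
      inner ℂ (T (u j)) (T (u k))).PosSemidef := by
  rw [Matrix.posSemidef_iff_dotProduct_mulVec]
  constructor
  · ext j k
    simp
  · intro c
    have h1 : star c ⬝ᵥ (Matrix.of fun j k => (‖T‖ : ℂ) ^ 2 * inner ℂ (u j) (u k) -
      inner ℂ (T (u j)) (T (u k))).mulVec c =
        (‖T‖ : ℂ) ^ 2 * inner ℂ (∑ j, c j • u j) (∑ j, c j • u j) -
          inner ℂ (T (∑ j, c j • u j)) (T (∑ j, c j • u j)) := by
      simp only [dotProduct, Matrix.mulVec, map_sum, map_smul, sum_inner, inner_sum,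
        inner_smul_left, inner_smul_right, Finset.mul_sum, ← Finset.sum_sub_distrib,
        Pi.star_apply, Matrix.of_apply, Complex.star_def]
      rw [Finset.sum_comm]
      refine Finset.sum_congr rfl fun j _ => Finset.sum_congr rfl fun k _ => by ring
    rw [h1, inner_self_eq_norm_sq_to_K, inner_self_eq_norm_sq_to_K]
    have h2 := T.le_opNorm (∑ j, c j • u j)
    have h3 : ‖T (∑ j, c j • u j)‖ ^ 2 ≤ (‖T‖ * ‖∑ j, c j • u j‖) ^ 2 := by gcongr
    rw [mul_pow] at h3
    have h4 : (0 : ℝ) ≤ ‖T‖ ^ 2 * ‖∑ j, c j • u j‖ ^ 2 - ‖T (∑ j, c j • u j)‖ ^ 2 := by linarith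
    have h5 := Complex.zero_le_real.2 h4
    push_cast at h5
    simpa using h5

theorem posSemidef_prod {F : Type*} [NormedAddCommGroup F] [InnerProductSpace ℂ F] {N : ℕ}
    (u : Fin N → Fin n → F) (s : Finset (Fin n)) :
    (Matrix.of fun j k => ∏ i ∈ s, inner ℂ (u j i) (u k i)).PosSemidef := by
  classical
  induction s using Finset.induction_on with
  | empty =>
    have h := Matrix.posSemidef_gram ℂ (fun _ : Fin N => (1 : ℂ))
    convert! h using 1
    ext j k
    simp [Matrix.gram]
  | insert i s hi ih =>
    have h := (Matrix.posSemidef_gram ℂ (fun j => u j i)).hadamard ih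
    convert! h using 1
    ext j k
    simp [Matrix.gram, Finset.prod_insert hi]

theorem posSemidef_prod_sub {F : Type*} [NormedAddCommGroup F] [InnerProductSpace ℂ F]
    (T : E →L[ℂ] F) {N : ℕ} (u : Fin N → Fin n → E) (s : Finset (Fin n)) :
    (Matrix.of fun j k => ∏ i ∈ s, (‖T‖ : ℂ) ^ 2 * inner ℂ (u j i) (u k i) -
      ∏ i ∈ s, inner ℂ (T (u j i)) (T (u k i))).PosSemidef := by
  classical
  induction s using Finset.induction_on with
  | empty =>
    convert! Matrix.PosSemidef.zero (n := Fin N) (R := ℂ) using 1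
    ext j k
    simp
  | insert i s hi ih =>
    have hc : (0 : ℂ) ≤ (‖T‖ : ℂ) ^ 2 := by exact_mod_cast sq_nonneg ‖T‖
    have h1 := ((Matrix.posSemidef_gram ℂ (fun j => u j i)).smul hc).hadamard ih
    have h2 := (posSemidef_gram_sub T (fun j => u j i)).hadamard
      (posSemidef_prod (fun j i => T (u j i)) s)
    convert! h1.add h2 using 1
    ext j k
    simp [Matrix.gram, Finset.prod_insert hi]
    ring

/-- The scalar product of the algebraic tensor power; positivity is Schur's product theorem. -/
instance algCore : PreInnerProductSpace.Core ℂ (AlgTensorPower E n) where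
  inner x y := algForm y x
  conj_inner_symm x y := by
    obtain ⟨N, c, u, rfl⟩ := alg_exists_sum x
    obtain ⟨M, c', u', rfl⟩ := alg_exists_sum y
    rw [algForm_sum, algForm_sum, Finset.sum_comm]
    simp only [map_sum, map_mul, map_prod, inner_conj_symm, Complex.star_def, Complex.conj_conj]
    refine Finset.sum_congr rfl fun j _ => Finset.sum_congr rfl fun k _ => by ring
  re_inner_nonneg x := by
    obtain ⟨N, c, u, rfl⟩ := alg_exists_sum x
    rw [algForm_sum]
    exact (RCLike.le_iff_re_im.1 (posSemidef_quad (posSemidef_prod u Finset.univ) c)).1.trans_eq'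
      (by simp)
  add_left x y z := by simp
  smul_left x y r := by simp

instance : SeminormedAddCommGroup (AlgTensorPower E n) :=
  InnerProductSpace.Core.toSeminormedAddCommGroup (𝕜 := ℂ)

instance : InnerProductSpace ℂ (AlgTensorPower E n) := InnerProductSpace.ofCore _

theorem inner_algTprod (u v : Fin n → E) :
    inner ℂ (algTprod u) (algTprod v) = ∏ i, inner ℂ (u i) (v i) :=
  algForm_algTprod u v

theorem alg_inner_sum {N M : ℕ} (c : Fin N → ℂ) (u : Fin N → Fin n → E)
    (c' : Fin M → ℂ) (u' : Fin M → Fin n → E) :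
    inner ℂ (∑ j, c j • algTprod (u j)) (∑ k, c' k • algTprod (u' k)) =
      ∑ j, ∑ k, star (c j) * (∏ i, inner ℂ (u j i) (u' k i)) * c' k :=
  algForm_sum c u c' u'


variable (E n) in
/-- The Hilbert space tensor power `E^{⊗n}`. -/
abbrev TensorPow : Type _ := UniformSpace.Completion (AlgTensorPower E n)

/-- The pure tensor `u₁ ⊗ ⋯ ⊗ uₙ` in `E^{⊗n}`. -/
def tprod (u : Fin n → E) : TensorPow E n := (algTprod u : AlgTensorPower E n)

theorem inner_tprod (u v : Fin n → E) :
    inner ℂ (tprod u) (tprod v) = ∏ i, inner ℂ (u i) (v i) := by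
  rw [tprod, tprod, UniformSpace.Completion.inner_coe, inner_algTprod]

/-- `T ⊗ ⋯ ⊗ T` on the algebraic tensor power. -/
def algTensorMap {F : Type*} [NormedAddCommGroup F] [InnerProductSpace ℂ F] (T : E →L[ℂ] F)
    (n : ℕ) : AlgTensorPower E n →ₗ[ℂ] AlgTensorPower F n :=
  algLift (algTprod.compLinearMap fun _ => T.toLinearMap)

@[simp] theorem algTensorMap_algTprod {F : Type*} [NormedAddCommGroup F] [InnerProductSpace ℂ F]
    (T : E →L[ℂ] F) (u : Fin n → E) :
    algTensorMap T n (algTprod u) = algTprod fun i => T (u i) := by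
  simp [algTensorMap]

theorem norm_algTensorMap_le {F : Type*} [NormedAddCommGroup F] [InnerProductSpace ℂ F]
    (T : E →L[ℂ] F) (x : AlgTensorPower E n) : ‖algTensorMap T n x‖ ≤ ‖T‖ ^ n * ‖x‖ := by
  obtain ⟨N, c, u, rfl⟩ := alg_exists_sum x
  have h := posSemidef_quad (posSemidef_prod_sub T u Finset.univ) c
  have h1 : ∑ j, ∑ k, star (c j) * (Matrix.of fun j k =>
      ∏ i, (‖T‖ : ℂ) ^ 2 * inner ℂ (u j i) (u k i) -
        ∏ i, inner ℂ (T (u j i)) (T (u k i))) j k * c k =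
      ((‖T‖ ^ n * ‖∑ j, c j • algTprod (u j)‖) ^ 2 -
        ‖algTensorMap T n (∑ j, c j • algTprod (u j))‖ ^ 2 : ℝ) := by
    have e1 := inner_self_eq_norm_sq_to_K (𝕜 := ℂ) (∑ j, c j • algTprod (u j))
    have e2 := inner_self_eq_norm_sq_to_K (𝕜 := ℂ)
      (algTensorMap T n (∑ j, c j • algTprod (u j)))
    simp only [map_sum, map_smul, algTensorMap_algTprod] at e2
    rw [alg_inner_sum] at e1 e2
    push_cast
    simp only [map_sum, map_smul, algTensorMap_algTprod]
    rw [mul_pow]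
    simp only [Complex.coe_algebraMap] at e1 e2
    rw [← e1, ← e2]
    simp only [Finset.mul_sum, ← Finset.sum_sub_distrib, Matrix.of_apply]
    refine Finset.sum_congr rfl fun j _ => Finset.sum_congr rfl fun k _ => ?_
    rw [Finset.prod_mul_distrib, Finset.prod_const, Finset.card_univ, Fintype.card_fin]
    ring
  rw [h1, Complex.zero_le_real] at h
  exact le_of_sq_le_sq (by linarith) (by positivity)

/-- The bounded operator `T ⊗ ⋯ ⊗ T : E^{⊗n} → F^{⊗n}`. -/
def tensorMap {F : Type*} [NormedAddCommGroup F] [InnerProductSpace ℂ F] (T : E →L[ℂ] F)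
    (n : ℕ) : TensorPow E n →L[ℂ] TensorPow F n :=
  ((algTensorMap T n).mkContinuous (‖T‖ ^ n) (norm_algTensorMap_le T)).completion

theorem tensorMap_tprod {F : Type*} [NormedAddCommGroup F] [InnerProductSpace ℂ F]
    (T : E →L[ℂ] F) (u : Fin n → E) : tensorMap T n (tprod u) = tprod fun i => T (u i) := by
  simp [tensorMap, tprod]

/-- `x ↦ h ⊗ x` on the algebraic tensor powers. -/
def algTensorLeft (h : E) (n : ℕ) : AlgTensorPower E n →ₗ[ℂ] AlgTensorPower E (n + 1) :=
  algLift (algTprod.curryLeft h)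

theorem algTensorLeft_algTprod (h : E) (u : Fin n → E) :
    algTensorLeft h n (algTprod u) = algTprod (Fin.cons h u : Fin (n + 1) → E) := by
  simp [algTensorLeft]

theorem norm_algTensorLeft (h : E) (x : AlgTensorPower E n) :
    ‖algTensorLeft h n x‖ = ‖h‖ * ‖x‖ := by
  obtain ⟨N, c, u, rfl⟩ := alg_exists_sum x
  have e1 := inner_self_eq_norm_sq_to_K (𝕜 := ℂ) (∑ j, c j • algTprod (u j))
  have e2 := inner_self_eq_norm_sq_to_K (𝕜 := ℂ)
    (algTensorLeft h n (∑ j, c j • algTprod (u j)))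
  have e3 := inner_self_eq_norm_sq_to_K (𝕜 := ℂ) h
  have e4 : ((‖algTensorLeft h n (∑ j, c j • algTprod (u j))‖ ^ 2 : ℝ) : ℂ) =
      ((‖h‖ * ‖∑ j, c j • algTprod (u j)‖) ^ 2 : ℝ) := by
    push_cast
    rw [mul_pow]
    simp only [Complex.coe_algebraMap] at e1 e2 e3
    rw [← e1, ← e2, ← e3]
    simp only [map_sum, map_smul, algTensorLeft_algTprod]
    rw [alg_inner_sum, alg_inner_sum]
    simp only [Finset.mul_sum, Fin.prod_univ_succ, Fin.cons_zero, Fin.cons_succ]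
    refine Finset.sum_congr rfl fun j _ => Finset.sum_congr rfl fun k _ => by ring
  exact (sq_eq_sq₀ (norm_nonneg _) (by positivity)).1 (Complex.ofReal_injective e4)

/-- The bounded operator `x ↦ h ⊗ x` from `E^{⊗n}` to `E^{⊗(n+1)}`. -/
def tensorLeft (h : E) (n : ℕ) : TensorPow E n →L[ℂ] TensorPow E (n + 1) :=
  ((algTensorLeft h n).mkContinuous ‖h‖ fun x => (norm_algTensorLeft h x).le).completion

theorem tensorLeft_tprod (h : E) (u : Fin n → E) :
    tensorLeft h n (tprod u) = tprod (Fin.cons h u : Fin (n + 1) → E) := by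
  simp [tensorLeft, tprod, algTensorLeft_algTprod]

theorem norm_tensorLeft (h : E) (x : TensorPow E n) : ‖tensorLeft h n x‖ = ‖h‖ * ‖x‖ := by
  induction x using UniformSpace.Completion.induction_on with
  | hp => exact isClosed_eq (by fun_prop) (by fun_prop)
  | ih x => simp [tensorLeft, norm_algTensorLeft]

variable (E) in
/-- The full (free) Fock space `⨁ₙ E^{⊗n}` (Hilbert space direct sum over `n ≥ 0`). -/
abbrev FreeFock : Type _ := lp (fun n => TensorPow E n) 2

/-- The symmetrized tensor `u₁ ∘ ⋯ ∘ uₙ = (1/n!) ∑_s u_{s(1)} ⊗ ⋯ ⊗ u_{s(n)}` in `E^{⊗n}`. -/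
def symTprod (u : Fin n → E) : TensorPow E n :=
  ((n.factorial : ℂ)⁻¹) • ∑ s : Equiv.Perm (Fin n), tprod fun i => u (s i)

variable (E n) in
/-- The closed subspace of `E^{⊗n}` spanned by the symmetrized tensors. -/
def symSubspace : Submodule ℂ (TensorPow E n) :=
  (Submodule.span ℂ (Set.range (symTprod (E := E) (n := n)))).topologicalClosure

instance : CompleteSpace (symSubspace E n) :=
  inferInstanceAs (CompleteSpace
    (Submodule.span ℂ (Set.range (symTprod (E := E) (n := n)))).topologicalClosure)

variable (E n) in
/-- The `n`-th symmetric tensor power `E^{∘n}` as a Hilbert space. -/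
abbrev SymPow : Type _ := symSubspace E n

/-- `u₁ ∘ ⋯ ∘ uₙ` as an element of `E^{∘n}`; for `n = 0` this is the vacuum vector. -/
def symProd (u : Fin n → E) : SymPow E n :=
  ⟨symTprod u, Submodule.le_topologicalClosure _ (Submodule.subset_span ⟨u, rfl⟩)⟩

theorem inner_symTprod_tprod (u v : Fin n → E) :
    inner ℂ (symTprod u) (tprod v) =
      (n.factorial : ℂ)⁻¹ * ∑ s : Equiv.Perm (Fin n), ∏ i, inner ℂ (u i) (v (s i)) := by
  simp only [symTprod, inner_smul_left, sum_inner, inner_tprod, map_inv₀, map_natCast]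
  congr 1
  refine Fintype.sum_equiv (Equiv.inv _) _ _ fun s => ?_
  rw [← Equiv.prod_comp s (fun i => inner ℂ (u i) (v ((Equiv.inv _ s) i)))]
  simp

theorem inner_symTprod (u v : Fin n → E) :
    inner ℂ (symTprod u) (symTprod v) = inner ℂ (symTprod u) (tprod v) := by
  have h : ∀ t : Equiv.Perm (Fin n), inner ℂ (symTprod u) (tprod fun i => v (t i)) =
      inner ℂ (symTprod u) (tprod v) := by
    intro t
    rw [inner_symTprod_tprod, inner_symTprod_tprod]
    congr 1
    exact Fintype.sum_equiv (Equiv.mulLeft t) _ _ fun s => by simp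
  have hn : (n.factorial : ℂ) ≠ 0 := by exact_mod_cast n.factorial_ne_zero
  conv_lhs => rw [symTprod.eq_def (u := v)]
  simp only [inner_smul_right, inner_sum, h, Finset.sum_const, Finset.card_univ,
    Fintype.card_perm, Fintype.card_fin, nsmul_eq_mul]
  field_simp

theorem inner_symProd (u v : Fin n → E) :
    inner ℂ (symProd u) (symProd v) =
      (n.factorial : ℂ)⁻¹ * ∑ s : Equiv.Perm (Fin n), ∏ i, inner ℂ (u i) (v (s i)) :=
  (inner_symTprod u v).trans (inner_symTprod_tprod u v)

theorem symTprod_perm (u : Fin n → E) (t : Equiv.Perm (Fin n)) :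
    symTprod (fun i => u (t i)) = symTprod u := by
  rw [symTprod, symTprod]
  congr 1
  exact Fintype.sum_equiv (Equiv.mulLeft t) _ _ fun s => by simp

theorem orthogonalProjectionOnto_tprod (u : Fin n → E) :
    (symSubspace E n).orthogonalProjectionOnto (tprod u) = symProd u := by
  refine Subtype.ext ?_
  refine Submodule.eq_starProjection_of_mem_orthogonal (symProd u).2 ?_
  change _ ∈ (Submodule.span ℂ (Set.range (symTprod (E := E) (n := n)))).topologicalClosureᗮ
  rw [Submodule.orthogonal_closure, Submodule.mem_orthogonal]
  intro w hw
  induction hw using Submodule.span_induction with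
  | mem w hw =>
    obtain ⟨v, rfl⟩ := hw
    rw [inner_sub_right, sub_eq_zero]
    exact (inner_symTprod v u).symm
  | zero => exact inner_zero_left _
  | add x y _ _ hx hy => rw [inner_add_left, hx, hy, add_zero]
  | smul c x _ hx => rw [inner_smul_left, hx, mul_zero]

theorem tensorMap_symTprod {F : Type*} [NormedAddCommGroup F] [InnerProductSpace ℂ F]
    (T : E →L[ℂ] F) (u : Fin n → E) : tensorMap T n (symTprod u) = symTprod fun i => T (u i) := by
  simp [symTprod, tensorMap_tprod]

theorem tensorMap_mem {F : Type*} [NormedAddCommGroup F] [InnerProductSpace ℂ F]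
    (T : E →L[ℂ] F) (x : TensorPow E n) (hx : x ∈ symSubspace E n) :
    tensorMap T n x ∈ symSubspace F n := by
  refine map_mem_closure (tensorMap T n).continuous hx fun y hy => ?_
  induction hy using Submodule.span_induction with
  | mem y hy =>
    obtain ⟨u, rfl⟩ := hy
    exact Submodule.subset_span ⟨_, (tensorMap_symTprod T u).symm⟩
  | zero => rw [map_zero]; exact Submodule.zero_mem _
  | add x y _ _ hx hy => rw [map_add]; exact Submodule.add_mem _ hx hy
  | smul c x _ hx => rw [map_smul]; exact Submodule.smul_mem _ c hx

/-- The restriction of `T ⊗ ⋯ ⊗ T` to symmetric tensors. -/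
def symMap {F : Type*} [NormedAddCommGroup F] [InnerProductSpace ℂ F] (T : E →L[ℂ] F)
    (n : ℕ) : SymPow E n →L[ℂ] SymPow F n :=
  (tensorMap T n).restrict (tensorMap_mem T)

theorem symMap_symProd {F : Type*} [NormedAddCommGroup F] [InnerProductSpace ℂ F]
    (T : E →L[ℂ] F) (u : Fin n → E) : symMap T n (symProd u) = symProd fun i => T (u i) :=
  Subtype.ext (tensorMap_symTprod T u)

/-- The `n`-particle part of boson creation, `x ↦ √(n+1) · Sym(h ⊗ x)`, with `Sym` the orthogonal
projection onto the symmetric tensors. -/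
def symLeft (h : E) (n : ℕ) : SymPow E n →L[ℂ] SymPow E (n + 1) :=
  (Real.sqrt (n + 1) : ℂ) •
    ((symSubspace E (n + 1)).orthogonalProjectionOnto ∘L tensorLeft h n ∘L
      (symSubspace E n).subtypeL)

theorem symLeft_symProd (h : E) (u : Fin n → E) :
    symLeft h n (symProd u) =
      (Real.sqrt (n + 1) : ℂ) • symProd (Fin.cons h u : Fin (n + 1) → E) := by
  have hn : (n.factorial : ℂ) ≠ 0 := by exact_mod_cast n.factorial_ne_zero
  have key : ∀ s : Equiv.Perm (Fin n), symProd (Fin.cons h (fun i => u (s i)) : Fin (n + 1) → E) =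
      symProd (Fin.cons h u : Fin (n + 1) → E) := by
    intro s
    refine Subtype.ext ?_
    refine Eq.trans (congrArg symTprod ?_)
      (symTprod_perm (Fin.cons h u : Fin (n + 1) → E) (Equiv.Perm.decomposeFin.symm (0, s)))
    funext i
    refine Fin.cases ?_ (fun j => ?_) i <;> simp
  simp only [symLeft, smul_apply, ContinuousLinearMap.comp_apply,
    Submodule.subtypeL_apply]
  congr 1
  change (symSubspace E (n + 1)).orthogonalProjectionOnto (tensorLeft h n (symTprod u)) = _
  simp only [symTprod, map_smul, map_sum, tensorLeft_tprod, orthogonalProjectionOnto_tprod, key,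
    Finset.sum_const, Finset.card_univ, Fintype.card_perm, Fintype.card_fin]
  rw [← Nat.cast_smul_eq_nsmul ℂ, smul_smul, inv_mul_cancel₀ hn, one_smul]

variable (E) in
/-- The symmetric Fock space `Γ(E) = ⨁ₙ E^{∘n}` (Hilbert space direct sum over `n ≥ 0`). -/
abbrev SymFock : Type _ := lp (fun n => SymPow E n) 2

variable (E) in
/-- Vectors of the symmetric Fock space with finitely many particles (algebraic direct sum). -/
abbrev FinSymFock : Type _ := DirectSum ℕ fun n => SymPow E n

/-- The inclusion of the finite particle vectors into the symmetric Fock space. -/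
def FinSymFock.toFock : FinSymFock E →ₗ[ℂ] SymFock E :=
  DirectSum.toModule ℂ ℕ (SymFock E) fun n => lp.lsingle 2 n

/-- The components of `f ⊗ ξ`: `0` in degree `0` and `f ⊗ ξₙ` in degree `n + 1`. -/
def freeShift (f : E) (ξ : ∀ n, TensorPow E n) : ∀ n, TensorPow E n
  | 0 => 0
  | n + 1 => tensorLeft f n (ξ n)

theorem hasSum_freeShift (f : E) (ξ : FreeFock E) :
    HasSum (fun n => ‖freeShift f ξ n‖ ^ (2 : ℝ)) ((‖f‖ * ‖ξ‖) ^ (2 : ℝ)) := by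
  rw [← hasSum_nat_add_iff' 1]
  have h := (lp.hasSum_norm (p := 2) (by norm_num) ξ).mul_left (‖f‖ ^ (2 : ℝ))
  simpa [freeShift, norm_tensorLeft, mul_pow] using h

theorem memℓp_freeShift (f : E) (ξ : FreeFock E) : Memℓp (freeShift f ξ) 2 :=
  (memℓp_gen_iff (p := 2) (by norm_num)).2 (by simpa using (hasSum_freeShift f ξ).summable)

/-- The free creation operator `a*(f)` on the full Fock space: `a*(f) ω = f`,
`a*(f) (f₁ ⊗ ⋯ ⊗ fₙ) = f ⊗ f₁ ⊗ ⋯ ⊗ fₙ`. -/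
def freeCreation (f : E) : FreeFock E →L[ℂ] FreeFock E :=
  LinearMap.mkContinuous
    { toFun := fun ξ => ⟨freeShift f ξ, memℓp_freeShift f ξ⟩
      map_add' := fun ξ η => by
        refine lp.ext (funext fun n => ?_)
        cases n with
        | zero => exact (add_zero _).symm
        | succ n => exact map_add (tensorLeft f n) (ξ n) (η n)
      map_smul' := fun c ξ => by
        refine lp.ext (funext fun n => ?_)
        cases n with
        | zero => exact (smul_zero c).symm
        | succ n => exact map_smul (tensorLeft f n) c (ξ n) }
    ‖f‖ fun ξ => by
      have h := (lp.hasSum_norm (p := 2) (by norm_num)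
        (⟨freeShift f ξ, memℓp_freeShift f ξ⟩ : FreeFock E)).unique
        (by simpa using hasSum_freeShift f ξ)
      refine le_of_eq ((sq_eq_sq₀ (norm_nonneg _) (by positivity)).1 ?_)
      simpa using h

end TensorPower

section Fock
open scoped DirectSum
variable {E : Type*} [NormedAddCommGroup E] [InnerProductSpace ℂ E]

/-- `u₁ ∘ ⋯ ∘ uₙ` as a finite particle vector; for `n = 0` this is the vacuum vector `Ω`. -/
def finSymProd {n : ℕ} (u : Fin n → E) : FinSymFock E :=
  DirectSum.lof ℂ ℕ (fun n => SymPow E n) n (symProd u)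

/-- The boson creation operator `a*(h)` on finite particle vectors:
`a*(h) (u₁ ∘ ⋯ ∘ uₙ) = √(n+1) h ∘ u₁ ∘ ⋯ ∘ uₙ`. -/
def bosonCreation (h : E) : FinSymFock E →ₗ[ℂ] FinSymFock E :=
  DirectSum.toModule ℂ ℕ (FinSymFock E) fun n =>
    (DirectSum.lof ℂ ℕ (fun n => SymPow E n) (n + 1)).comp (symLeft h n).toLinearMap

/-- The second quantization of `T` on finite particle vectors:
`u₁ ∘ ⋯ ∘ uₙ ↦ T u₁ ∘ ⋯ ∘ T uₙ`, and `Ω ↦ Ω`. -/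
def secondQuantization (T : E →L[ℂ] E) : FinSymFock E →ₗ[ℂ] FinSymFock E :=
  DirectSum.lmap fun n => (symMap T n).toLinearMap

end Fock

section Cyclic
variable {V : Type*} [NormedAddCommGroup V] [InnerProductSpace ℂ V] [CompleteSpace V]

/-- The C*-algebra of bounded operators generated by `1` and the operators `L f`. -/
def generatedAlgebra {ι : Type*} (L : ι → (V →L[ℂ] V)) : StarSubalgebra ℂ (V →L[ℂ] V) :=
  (StarAlgebra.adjoin ℂ (Set.range L)).topologicalClosure

theorem mem_generatedAlgebra {ι : Type*} (L : ι → (V →L[ℂ] V)) (f : ι) :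
    L f ∈ generatedAlgebra L :=
  StarSubalgebra.le_topologicalClosure _ (StarAlgebra.subset_adjoin ℂ _ ⟨f, rfl⟩)

/-- The closed cyclic subspace `[C x]`. -/
def cyclicSubspace (C : StarSubalgebra ℂ (V →L[ℂ] V)) (x : V) : Submodule ℂ V :=
  (Submodule.span ℂ {y | ∃ A ∈ C, y = A x}).topologicalClosure

instance (C : StarSubalgebra ℂ (V →L[ℂ] V)) (x : V) : CompleteSpace (cyclicSubspace C x) :=
  inferInstanceAs (CompleteSpace (Submodule.span ℂ {y | ∃ A ∈ C, y = A x}).topologicalClosure)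

theorem cyclicSubspace_invariant (C : StarSubalgebra ℂ (V →L[ℂ] V)) (x : V) (A : C) (y : V)
    (hy : y ∈ cyclicSubspace C x) : (A : V →L[ℂ] V) y ∈ cyclicSubspace C x := by
  refine map_mem_closure (A : V →L[ℂ] V).continuous hy fun z hz => ?_
  induction hz using Submodule.span_induction with
  | mem z hz =>
    obtain ⟨B, hB, rfl⟩ := hz
    exact Submodule.subset_span ⟨A * B, mul_mem A.2 hB, rfl⟩
  | zero => rw [map_zero]; exact Submodule.zero_mem _
  | add x y _ _ hx hy => rw [map_add]; exact Submodule.add_mem _ hx hy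
  | smul c x _ hx => rw [map_smul]; exact Submodule.smul_mem _ c hx

/-- The representation `π_x : A ↦ A|_{[C x]}` of `C` on `[C x]`. -/
def cyclicRepresentation (C : StarSubalgebra ℂ (V →L[ℂ] V)) (x : V) :
    C →⋆ₐ[ℂ] (cyclicSubspace C x →L[ℂ] cyclicSubspace C x) where
  toFun A := (A : V →L[ℂ] V).restrict (cyclicSubspace_invariant C x A)
  map_one' := rfl
  map_mul' _ _ := rfl
  map_zero' := rfl
  map_add' _ _ := rfl
  commutes' _ := rfl
  map_star' A := by
    refine (ContinuousLinearMap.eq_adjoint_iff _ _).2 fun y z => ?_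
    exact ContinuousLinearMap.adjoint_inner_left (A : V →L[ℂ] V) (z : V) (y : V)

end Cyclic

section Free
open MeasureTheory Filter Topology

/-- Lebesgue measure on `ℝ⁺ = [0, ∞)`. -/
def halfLine : Measure ℝ := volume.restrict (Set.Ici 0)

/-- `K = L²(ℝ⁺)`. -/
abbrev OneParticle : Type := Lp ℂ 2 halfLine

/-- `H = L²(ℝ⁺, G) ≅ K ⊗ G`, with multiplicity space `G`. -/
abbrev ColouredParticle (G : Type*) [NormedAddCommGroup G] : Type _ := Lp G 2 halfLine

variable {G : Type*} [NormedAddCommGroup G] [InnerProductSpace ℂ G]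

/-- The vector `f ⊗ g` of `H`, that is, the function `t ↦ f(t) g`. -/
def elemTensor (f : OneParticle) (g : G) : ColouredParticle G :=
  (ContinuousLinearMap.toSpanSingleton ℂ g).compLp f

-- The orthonormal basis `e` of `G` is indexed from `0`: `f ⊗ e k` is a vector of colour `k + 1`.
variable (e : HilbertBasis ℕ ℂ G)

/-- `H^(σ)`, the closed subspace of `H` spanned by the `f ⊗ e k` with `k ∈ σ`. -/
def colourSubspace (σ : Set ℕ) : Submodule ℂ (ColouredParticle G) :=
  (Submodule.span ℂ {u | ∃ f : OneParticle, ∃ k ∈ σ, u = elemTensor f (e k)}).topologicalClosure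

instance [CompleteSpace G] (σ : Set ℕ) : CompleteSpace (colourSubspace e σ) :=
  inferInstanceAs (CompleteSpace (Submodule.span ℂ
    {u | ∃ f : OneParticle, ∃ k ∈ σ, u = elemTensor f (e k)}).topologicalClosure)

variable [CompleteSpace G]

/-- The canonical (orthogonal) projection `Π^(σ)` of `H` onto `H^(σ)`. -/
def colourProjection (σ : Set ℕ) : ColouredParticle G →L[ℂ] ColouredParticle G :=
  (colourSubspace e σ).starProjection

/-- The filtered creation operator `a^(σ)*(h) = a*(h) P^(σ)`, where `P^(σ)` is the second
quantization of `Π^(σ)`. -/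
def filteredCreation (σ : Set ℕ) (h : ColouredParticle G) :
    FinSymFock (ColouredParticle G) →ₗ[ℂ] FinSymFock (ColouredParticle G) :=
  bosonCreation h ∘ₗ secondQuantization (colourProjection e σ)

/-- `a^(r)*(h)`: for `r ≥ 1` the filtered creation operator whose filter consists of the colours
`1, …, r - 1` (the indices below `r - 1`), and `0` for `r = 0`. -/
def initialCreation : ℕ → ColouredParticle G →
    FinSymFock (ColouredParticle G) →ₗ[ℂ] FinSymFock (ColouredParticle G)
  | 0, _ => 0
  | r + 1, h => filteredCreation e {j | j < r} h

/-- The extended `m`-free creation operator: the sum over the colours `k = 1, …, m` of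
`a^(k)*(f ⊗ e_k) - a^(k-1)*(f ⊗ e_k)`; the summation index below is the colour minus `1`. -/
def mFreeCreation (m : ℕ) (f : OneParticle) :
    FinSymFock (ColouredParticle G) →ₗ[ℂ] FinSymFock (ColouredParticle G) :=
  ∑ k ∈ Finset.range m, (initialCreation e (k + 1) (elemTensor f (e k)) -
    initialCreation e k (elemTensor f (e k)))

/-- The bounded operator `T` on `Γ(H)` extends the operator `l*(f)`, the strong limit for `m → ∞` of
the extended `m`-free creation operators on the linear span of the vectors
`(g₁ ⊗ e_{k₁}) ∘ ⋯ ∘ (gₙ ⊗ e_{kₙ})` (`n ≥ 0`). -/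
def IsExtendedFreeCreation (f : OneParticle)
    (T : SymFock (ColouredParticle G) →L[ℂ] SymFock (ColouredParticle G)) : Prop :=
  ∀ (n : ℕ) (g : Fin n → OneParticle) (k : Fin n → ℕ),
    Tendsto (fun m => (mFreeCreation e m f (finSymProd fun i => elemTensor (g i) (e (k i)))).toFock)
      atTop (𝓝 (T (finSymProd fun i => elemTensor (g i) (e (k i))).toFock))

/-- `ρ` is the free Fock space representation: it sends each generator `L f` to the free creation
operator `a*(f)` on the full Fock space. -/
def IsFreeFockRepresentation
    (L : OneParticle → (SymFock (ColouredParticle G) →L[ℂ] SymFock (ColouredParticle G)))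
    (ρ : generatedAlgebra L →⋆ₐ[ℂ] (FreeFock OneParticle →L[ℂ] FreeFock OneParticle)) : Prop :=
  ∀ f, ρ ⟨L f, mem_generatedAlgebra L f⟩ = freeCreation f

/-- The index data of the basis vectors `(d_{i₁} ⊗ e_{k₁}) ∘ ⋯ ∘ (d_{iₙ} ⊗ e_{kₙ})` that are used:
the colours increase weakly, the `d`-indices increase weakly among equal colours, and the last
colour is not the successor of the preceding one, nor equal to `1` (index `0`) if `n = 1`. -/
structure IsDefectIndex {n : ℕ} (i k : Fin n → ℕ) : Prop where
  colour_mono : Monotone k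
  index_mono : ∀ r s, r ≤ s → k r = k s → i r ≤ i s
  single : ∀ r : Fin n, n = 1 → k r ≠ 0
  last : ∀ r s : Fin n, (s : ℕ) + 1 = n → (r : ℕ) + 1 = s → k s ≠ k r + 1

/-- The vector `(d_{i₁} ⊗ e_{k₁}) ∘ ⋯ ∘ (d_{iₙ} ⊗ e_{kₙ})` of `Γ(H)`; for `n = 0` this is `Ω`. -/
def basisVector (d : HilbertBasis ℕ ℂ OneParticle) {n : ℕ} (i k : Fin n → ℕ) :
    SymFock (ColouredParticle G) :=
  (finSymProd fun r => elemTensor (d (i r)) (e (k r))).toFock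

/-- The set `D` of normalized vectors with admissible index data; it contains `Ω` (`n = 0`). -/
def defectVectors (d : HilbertBasis ℕ ℂ OneParticle) : Set (SymFock (ColouredParticle G)) :=
  {x | ∃ (n : ℕ) (i k : Fin n → ℕ), IsDefectIndex i k ∧
    x = ((‖basisVector e d i k‖ : ℂ)⁻¹) • basisVector e d i k}

end Free
end
end FilteredFock

/-!
The operators `L f = l*(f)` satisfy the relations `L(f)* L(g) = ⟪f, g⟫` of free creation operators.
On a product vector with largest colour `j` only one term of the defining series is nonzero, and it
adds a particle of colour `j + 1`. The new colour does not occur among the old ones, so in the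
scalar product of two such images only the permutations fixing the new particle survive
(`inner_symProd_cons`); this costs a factor `1 / (n + 1)`, which the `√(n + 1)` of boson creation
compensates. Images of vectors with different largest colours are orthogonal. Hence
`⟪L f v, L g w⟫ = ⟪f, g⟫ ⟪v, w⟫` on product vectors (`inner_creationVector`). As these are total,
the Gram matrix criterion `exists_continuousLinearMap_of_inner_eq` yields the bounded extension,
and the relation persists.

For such a family the decomposition is that of Wold. If a unit vector `x` is wandering, that is,
annihilated by all `L(f)*`, then the words `L(u₁) ⋯ L(uₙ) x` have the same Gram matrix as the
tensors `u₁ ⊗ ⋯ ⊗ uₙ` of the full Fock space, and their closed span is reduced by the generators.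
So `[C x]` is a copy of the full Fock space on which `L f` acts as free creation
(`exists_freeFock_equiv`). Conjugating with this unitary gives the representation `ρ`, which does
not depend on `x`, since star homomorphisms of C*-algebras are continuous and hence determined on
generators. Orthogonal wandering vectors have orthogonal cyclic subspaces (`wordSpan_isOrtho`).

The defect vectors are wandering because a vector in the range of some `L f` has a largest colour
that occurs once and succeeds the second largest, which is the excluded pattern
(`not_colours_eq_cons_nextColour`). Conversely a sorted basis vector with the excluded pattern is a
multiple of `L(d_i)` applied to a shorter sorted basis vector, so by induction on the particle
number every basis vector lies in each closed `L`-invariant subspace that contains the defect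
vectors (`basisVector_mem_of_monotone`).
-/

namespace FilteredFock
noncomputable section

/-! ### Operators prescribed on a total family -/

section Total

variable {V W : Type*} [NormedAddCommGroup V] [InnerProductSpace ℂ V]
  [NormedAddCommGroup W] [InnerProductSpace ℂ W]

theorem mem_of_dense_span {S : Set V} (hS : Dense (Submodule.span ℂ S : Set V))
    {M : Submodule ℂ V} (hM : IsClosed (M : Set V)) (h : S ⊆ M) (x : V) : x ∈ M :=
  closure_minimal (Submodule.span_le.2 h) hM (hS x)

theorem inner_map_map_of_dense_span {S : Set V} (hS : Dense (Submodule.span ℂ S : Set V))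
    (T T' : V →L[ℂ] W) (c : ℂ)
    (h : ∀ a ∈ S, ∀ b ∈ S, inner ℂ (T a) (T' b) = c * inner ℂ a b) (x y : V) :
    inner ℂ (T x) (T' y) = c * inner ℂ x y := by
  have h1 : ∀ b ∈ S, (innerSL ℂ (T' b)) ∘L T = star c • innerSL ℂ b := fun b hb =>
    ContinuousLinearMap.ext_on hS fun a ha => by
      simpa using congrArg star (h a ha b hb)
  have h2 : (innerSL ℂ (T x)) ∘L T' = c • innerSL ℂ x :=
    ContinuousLinearMap.ext_on hS fun b hb => by
      simpa using congrArg star (DFunLike.congr_fun (h1 b hb) x)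
  simpa using DFunLike.congr_fun h2 y

/-- A bounded operator may be prescribed on a total family whenever it multiplies the Gram matrix
of that family by a constant. -/
theorem exists_continuousLinearMap_of_inner_eq [CompleteSpace W] {ι : Type*} (v : ι → V)
    (w : ι → W) (hv : Dense (Submodule.span ℂ (Set.range v) : Set V)) (r : ℝ) (hr : 0 ≤ r)
    (h : ∀ a b, inner ℂ (w a) (w b) = (r : ℂ) ^ 2 * inner ℂ (v a) (v b)) :
    ∃ T : V →L[ℂ] W, ∀ a, T (v a) = w a := by
  have hdense : DenseRange (Finsupp.linearCombination ℂ v) := by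
    rw [← Finsupp.range_linearCombination] at hv
    exact hv
  have hnorm : ∀ x, ‖Finsupp.linearCombination ℂ w x‖ ≤ r * ‖Finsupp.linearCombination ℂ v x‖ := by
    intro x
    refine le_of_eq ((sq_eq_sq₀ (norm_nonneg _) (by positivity)).1 ?_)
    have e : inner ℂ (Finsupp.linearCombination ℂ w x) (Finsupp.linearCombination ℂ w x) =
        (r : ℂ) ^ 2 *
          inner ℂ (Finsupp.linearCombination ℂ v x) (Finsupp.linearCombination ℂ v x) := by
      simp only [Finsupp.linearCombination_apply, Finsupp.sum, sum_inner, inner_sum,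
        inner_smul_left, inner_smul_right, h, Finset.mul_sum]
      exact Finset.sum_congr rfl fun j _ => Finset.sum_congr rfl fun k _ => by ring
    rw [inner_self_eq_norm_sq_to_K, inner_self_eq_norm_sq_to_K] at e
    rw [mul_pow]
    refine Complex.ofReal_injective ?_
    push_cast
    exact e
  refine ⟨(Finsupp.linearCombination ℂ w).extendOfNorm (Finsupp.linearCombination ℂ v),
    fun a => ?_⟩
  have := LinearMap.extendOfNorm_eq hdense ⟨r, hnorm⟩ (Finsupp.single a 1)
  simpa using this

theorem dense_span_lp_single {X : ℕ → Type*} [∀ n, NormedAddCommGroup (X n)]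
    [∀ n, InnerProductSpace ℂ (X n)] {ι : ℕ → Type*} (v : ∀ n, ι n → X n)
    (hv : ∀ n, Dense (Submodule.span ℂ (Set.range (v n)) : Set (X n))) :
    Dense (Submodule.span ℂ (Set.range fun a : Σ n, ι n => lp.single 2 a.1 (v a.1 a.2)) :
      Set (lp X 2)) := by
  rw [Submodule.dense_iff_topologicalClosure_eq_top, eq_top_iff]
  rintro ξ -
  set M := (Submodule.span ℂ
    (Set.range fun a : Σ n, ι n => lp.single 2 a.1 (v a.1 a.2))).topologicalClosure with hM
  have hMc : IsClosed (M : Set (lp X 2)) := Submodule.isClosed_topologicalClosure _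
  refine hMc.mem_of_tendsto (lp.hasSum_single (by norm_num) ξ)
    (Filter.Eventually.of_forall fun s => Submodule.sum_mem _ fun n _ => ?_)
  refine mem_of_dense_span (hv n)
    (M := M.comap (lp.singleContinuousLinearMap ℂ X 2 n).toLinearMap)
    (hMc.preimage (lp.singleContinuousLinearMap ℂ X 2 n).continuous) ?_ (ξ n)
  rintro _ ⟨a, rfl⟩
  exact Submodule.le_topologicalClosure _ (Submodule.subset_span ⟨⟨n, a⟩, rfl⟩)

end Total

/-! ### Isometric families and their wandering vectors -/

section Wold

variable {E V : Type*} [NormedAddCommGroup V] [InnerProductSpace ℂ V]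

/-- The relations `L(f)* L(g) = ⟪f, g⟫` of free creation operators, in weak form. -/
def IsIsometricFamily [NormedAddCommGroup E] [InnerProductSpace ℂ E]
    (L : E → V →L[ℂ] V) : Prop :=
  ∀ f g v w, inner ℂ (L f v) (L g w) = inner ℂ f g * inner ℂ v w

/-- `x` is orthogonal to the ranges of all `L f`; equivalently, `L(f)* x = 0` for all `f`. -/
def IsWandering (L : E → V →L[ℂ] V) (x : V) : Prop :=
  ∀ f v, inner ℂ (L f v) x = 0

/-- The vector `L(u₁) ⋯ L(uₙ) x`. -/
def word (L : E → V →L[ℂ] V) (x : V) : ∀ {n : ℕ}, (Fin n → E) → V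
  | 0, _ => x
  | _ + 1, u => L (u 0) (word L x (Fin.tail u))

variable {L : E → V →L[ℂ] V} {x y : V}

theorem word_cons (f : E) {n : ℕ} (u : Fin n → E) :
    word L x (Fin.cons f u : Fin (n + 1) → E) = L f (word L x u) := by
  simp [word]

variable (L x) in
/-- The closed span of the words `L(u₁) ⋯ L(uₙ) x`. -/
def wordSpan : Submodule ℂ V :=
  (Submodule.span ℂ (Set.range fun a : Σ n, Fin n → E => word L x a.2)).topologicalClosure

theorem word_mem_wordSpan {n : ℕ} (u : Fin n → E) : word L x u ∈ wordSpan L x :=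
  Submodule.le_topologicalClosure _ (Submodule.subset_span ⟨⟨n, u⟩, rfl⟩)

theorem wordSpan_le {M : Submodule ℂ V} (hM : IsClosed (M : Set V))
    (h : ∀ (n : ℕ) (u : Fin n → E), word L x u ∈ M) : wordSpan L x ≤ M := by
  refine Submodule.topologicalClosure_minimal _ (Submodule.span_le.2 ?_) hM
  rintro _ ⟨a, rfl⟩
  exact h _ _

theorem isClosed_wordSpan : IsClosed (wordSpan L x : Set V) :=
  Submodule.isClosed_topologicalClosure _

theorem wordSpan_map_le {M : Submodule ℂ V} (hM : IsClosed (M : Set V)) (T : V →L[ℂ] V)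
    (h : ∀ (n : ℕ) (u : Fin n → E), T (word L x u) ∈ M) (z : V) (hz : z ∈ wordSpan L x) :
    T z ∈ M :=
  wordSpan_le (M := M.comap T.toLinearMap) (hM.preimage T.continuous) h hz

theorem adjoint_apply_wandering [CompleteSpace V] (hx : IsWandering L x) (f : E) :
    ContinuousLinearMap.adjoint (L f) x = 0 := by
  refine ext_inner_left ℂ fun w => ?_
  rw [ContinuousLinearMap.adjoint_inner_right, hx, inner_zero_right]

/-- A closed subspace reduced by all `L f` is invariant under the C*-algebra they generate. -/
theorem generatedAlgebra_apply_mem [CompleteSpace V] {M : Submodule ℂ V} (hM : IsClosed (M : Set V))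
    (h : ∀ f, ∀ v ∈ M, L f v ∈ M) (h' : ∀ f, ∀ v ∈ M, ContinuousLinearMap.adjoint (L f) v ∈ M)
    {A : V →L[ℂ] V} (hA : A ∈ generatedAlgebra L) {v : V} (hv : v ∈ M) : A v ∈ M := by
  have hcont : Continuous fun B : V →L[ℂ] V => B v := by fun_prop
  refine (closure_minimal (t := (fun B : V →L[ℂ] V => B v) ⁻¹' M) ?_ (hM.preimage hcont)) hA
  intro B hB
  -- Closure under `star` forces the induction to carry `B` and its adjoint together.
  have key : (∀ v ∈ M, B v ∈ M) ∧ ∀ v ∈ M, (star B) v ∈ M := by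
    induction hB using StarAlgebra.adjoin_induction with
    | mem B hB =>
      obtain ⟨f, rfl⟩ := hB
      exact ⟨h f, h' f⟩
    | algebraMap c =>
      refine ⟨fun v hv => M.smul_mem c hv, fun v hv => ?_⟩
      rw [← algebraMap_star_comm]
      exact M.smul_mem (star c) hv
    | add a b _ _ ha hb =>
      refine ⟨fun v hv => M.add_mem (ha.1 v hv) (hb.1 v hv), fun v hv => ?_⟩
      rw [star_add]
      exact M.add_mem (ha.2 v hv) (hb.2 v hv)
    | mul a b _ _ ha hb =>
      refine ⟨fun v hv => ha.1 _ (hb.1 v hv), fun v hv => ?_⟩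
      rw [star_mul]
      exact hb.2 _ (ha.2 v hv)
    | star a _ ha =>
      refine ⟨ha.2, fun v hv => ?_⟩
      rw [star_star]
      exact ha.1 v hv
  exact key.1 v hv

variable [NormedAddCommGroup E] [InnerProductSpace ℂ E]

theorem inner_word (hL : IsIsometricFamily L) {n : ℕ} (u v : Fin n → E) :
    inner ℂ (word L x u) (word L y v) = (∏ i, inner ℂ (u i) (v i)) * inner ℂ x y := by
  induction n with
  | zero => simp [word]
  | succ n ih =>
    rw [word, word, hL, ih, Fin.prod_univ_succ, mul_assoc]
    rfl

theorem inner_word_of_lt (hL : IsIsometricFamily L) (hy : IsWandering L y) {n m : ℕ} (hmn : m < n)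
    (u : Fin n → E) (v : Fin m → E) : inner ℂ (word L x u) (word L y v) = 0 := by
  induction n generalizing m with
  | zero => omega
  | succ n ih =>
    cases m with
    | zero => exact hy _ _
    | succ m => rw [word, word, hL, ih (by omega), mul_zero]

theorem inner_word_of_ne (hL : IsIsometricFamily L) (hx : IsWandering L x) (hy : IsWandering L y)
    {n m : ℕ} (hmn : n ≠ m) (u : Fin n → E) (v : Fin m → E) :
    inner ℂ (word L x u) (word L y v) = 0 := by
  rcases lt_or_gt_of_ne hmn with h | h
  · rw [← inner_conj_symm, inner_word_of_lt hL hx h, map_zero]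
  · exact inner_word_of_lt hL hy h u v

theorem inner_lp_single_tprod {n m : ℕ} (u : Fin n → E) (v : Fin m → E) :
    inner ℂ (lp.single 2 n (tprod u) : FreeFock E) (lp.single 2 m (tprod v)) =
      if h : n = m then ∏ i, inner ℂ (u i) (v (Fin.cast h i)) else 0 := by
  rw [lp.inner_single_left]
  split_ifs with h
  · subst h
    simp [inner_tprod]
  · rw [lp.single_apply_ne _ _ _ h, inner_zero_right]

theorem dense_span_tprod (n : ℕ) :
    Dense (Submodule.span ℂ (Set.range fun u : Fin n → E => tprod u) : Set (TensorPow E n)) := by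
  refine (UniformSpace.Completion.denseRange_coe (α := AlgTensorPower E n)).mono ?_
  rintro _ ⟨z, rfl⟩
  induction z using alg_induction with
  | smul c u =>
    rw [UniformSpace.Completion.coe_smul]
    exact Submodule.smul_mem _ _ (Submodule.subset_span ⟨u, rfl⟩)
  | add a b ha hb =>
    rw [UniformSpace.Completion.coe_add]
    exact Submodule.add_mem _ ha hb

theorem dense_span_freeFock : Dense (Submodule.span ℂ (Set.range
    fun a : Σ n, Fin n → E => (lp.single 2 a.1 (tprod a.2) : FreeFock E)) : Set (FreeFock E)) :=
  dense_span_lp_single (fun n (u : Fin n → E) => tprod u) dense_span_tprod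

theorem freeCreation_lp_single (f : E) {n : ℕ} (u : Fin n → E) :
    freeCreation f (lp.single 2 n (tprod u)) =
      lp.single 2 (n + 1) (tprod (Fin.cons f u : Fin (n + 1) → E)) := by
  refine lp.ext (funext fun m => ?_)
  change freeShift f _ m = _
  cases m with
  | zero => simp [freeShift]
  | succ m =>
    by_cases h : m = n
    · subst h
      simp [freeShift, tensorLeft_tprod]
    · simp [freeShift, h]

theorem wordSpan_isOrtho (hL : IsIsometricFamily L) (hx : IsWandering L x) (hy : IsWandering L y)
    (hxy : inner ℂ x y = 0) : wordSpan L x ⟂ wordSpan L y := by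
  rw [Submodule.IsOrtho]
  refine wordSpan_le (Submodule.isClosed_orthogonal _) fun n u => ?_
  rw [wordSpan, Submodule.orthogonal_closure, Submodule.mem_orthogonal]
  intro z hz
  induction hz using Submodule.span_induction with
  | mem z hz =>
    obtain ⟨⟨m, v⟩, rfl⟩ := hz
    by_cases h : m = n
    · subst h
      rw [inner_word hL, ← inner_conj_symm y x, hxy, map_zero, mul_zero]
    · exact inner_word_of_ne hL hy hx h v u
  | zero => exact inner_zero_left _
  | add x y _ _ hx hy => rw [inner_add_left, hx, hy, add_zero]
  | smul c x _ hx => rw [inner_smul_left, hx, mul_zero]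

variable [CompleteSpace V]

theorem adjoint_apply_apply (hL : IsIsometricFamily L) (f g : E) (v : V) :
    ContinuousLinearMap.adjoint (L f) (L g v) = (inner ℂ f g : ℂ) • v := by
  refine ext_inner_left ℂ fun w => ?_
  rw [ContinuousLinearMap.adjoint_inner_right, hL, inner_smul_right]

theorem self_mem_cyclicSubspace (C : StarSubalgebra ℂ (V →L[ℂ] V)) (x : V) :
    x ∈ cyclicSubspace C x :=
  Submodule.le_topologicalClosure _ (Submodule.subset_span ⟨1, one_mem C, rfl⟩)

/-- For a wandering vector the adjoints `L(f)*` produce no new directions. -/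
theorem cyclicSubspace_eq_wordSpan (hL : IsIsometricFamily L) (hx : IsWandering L x) :
    cyclicSubspace (generatedAlgebra L) x = wordSpan L x := by
  apply le_antisymm
  · refine Submodule.topologicalClosure_minimal _ (Submodule.span_le.2 ?_) isClosed_wordSpan
    rintro _ ⟨A, hA, rfl⟩
    refine generatedAlgebra_apply_mem isClosed_wordSpan (fun f => ?_) (fun f => ?_) hA
      (word_mem_wordSpan (n := 0) Fin.elim0)
    · refine wordSpan_map_le isClosed_wordSpan _ fun n u => ?_
      rw [← word_cons]
      exact word_mem_wordSpan _
    · refine wordSpan_map_le isClosed_wordSpan _ fun n u => ?_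
      cases n with
      | zero =>
        rw [word, adjoint_apply_wandering hx]
        exact Submodule.zero_mem _
      | succ n =>
        rw [word, adjoint_apply_apply hL]
        exact Submodule.smul_mem _ _ (word_mem_wordSpan _)
  · refine wordSpan_le (Submodule.isClosed_topologicalClosure _) fun n u => ?_
    induction n with
    | zero => exact self_mem_cyclicSubspace _ _
    | succ n ih =>
      exact cyclicSubspace_invariant _ x ⟨L (u 0), mem_generatedAlgebra L _⟩ _ (ih _)

/-- The cyclic subspace of a wandering unit vector is a copy of the full Fock space, on which
`L f` acts as the free creation operator. -/
theorem exists_freeFock_equiv (hL : IsIsometricFamily L) (hx : IsWandering L x) (hx1 : ‖x‖ = 1) :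
    ∃ U : FreeFock E ≃ₗᵢ[ℂ] cyclicSubspace (generatedAlgebra L) x,
      ∀ f φ, (U (freeCreation f φ) : V) = L f (U φ) := by
  have hxx : inner ℂ x x = (1 : ℂ) := by simp [inner_self_eq_norm_sq_to_K, hx1]
  have hgram : ∀ a b : Σ n, Fin n → E, inner ℂ (word L x a.2) (word L x b.2) =
      inner ℂ (lp.single 2 a.1 (tprod a.2) : FreeFock E) (lp.single 2 b.1 (tprod b.2)) := by
    rintro ⟨n, u⟩ ⟨m, v⟩
    rw [inner_lp_single_tprod]
    split_ifs with h
    · obtain rfl : n = m := h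
      rw [inner_word hL, hxx, mul_one]
      rfl
    · exact inner_word_of_ne hL hx hx h u v
  obtain ⟨T, hT⟩ := exists_continuousLinearMap_of_inner_eq
    (fun a : Σ n, Fin n → E => (lp.single 2 a.1 (tprod a.2) : FreeFock E))
    (fun a => word L x a.2) dense_span_freeFock 1 zero_le_one (by simpa using hgram)
  have hTi : ∀ φ ψ, inner ℂ (T φ) (T ψ) = inner ℂ φ ψ := fun φ ψ => by
    rw [inner_map_map_of_dense_span dense_span_freeFock T T 1 ?_ φ ψ, one_mul]
    rintro _ ⟨a, rfl⟩ _ ⟨b, rfl⟩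
    rw [hT, hT, hgram, one_mul]
  let S : FreeFock E →ₗᵢ[ℂ] V := T.toLinearMap.isometryOfInner hTi
  have hrange : LinearMap.range S.toLinearMap = cyclicSubspace (generatedAlgebra L) x := by
    rw [cyclicSubspace_eq_wordSpan hL hx]
    apply le_antisymm
    · rintro _ ⟨φ, rfl⟩
      refine mem_of_dense_span dense_span_freeFock (M := (wordSpan L x).comap T.toLinearMap)
        (isClosed_wordSpan.preimage T.continuous) ?_ φ
      rintro _ ⟨a, rfl⟩
      have h := word_mem_wordSpan (L := L) (x := x) a.2
      rw [← hT] at h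
      exact h
    · exact wordSpan_le S.isometry.isClosedEmbedding.isClosed_range fun n u => ⟨_, hT ⟨n, u⟩⟩
  refine ⟨S.equivRange.trans (LinearIsometryEquiv.ofEq _ _ hrange), fun f φ => ?_⟩
  have h : T ∘L freeCreation f = L f ∘L T := by
    refine ContinuousLinearMap.ext_on dense_span_freeFock ?_
    rintro _ ⟨⟨n, u⟩, rfl⟩
    have h1 := hT ⟨n + 1, Fin.cons f u⟩
    have h2 := hT ⟨n, u⟩
    simp only at h1 h2
    rw [ContinuousLinearMap.comp_apply, ContinuousLinearMap.comp_apply, freeCreation_lp_single,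
      h1, h2, word_cons]
  exact DFunLike.congr_fun h φ

/-- Star homomorphisms on the generated C*-algebra are automatically continuous, so they are
determined by the images of the generators. -/
theorem starAlgHom_generatedAlgebra_ext {ι W : Type*} [NormedAddCommGroup W]
    [InnerProductSpace ℂ W] [CompleteSpace W] {L : ι → V →L[ℂ] V}
    {φ ψ : generatedAlgebra L →⋆ₐ[ℂ] (W →L[ℂ] W)}
    (h : ∀ f, φ ⟨L f, mem_generatedAlgebra L f⟩ = ψ ⟨L f, mem_generatedAlgebra L f⟩) : φ = ψ := by
  have hclosed : IsClosed (generatedAlgebra L : Set (V →L[ℂ] V)) :=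
    StarSubalgebra.isClosed_topologicalClosure _
  let _ : CStarAlgebra (V →L[ℂ] V) := {}
  let _ : CStarAlgebra (W →L[ℂ] W) := {}
  let _ : CStarAlgebra (generatedAlgebra L) :=
    StarSubalgebra.cstarAlgebra (generatedAlgebra L) (h_closed := hclosed)
  have hcont : ∀ χ : generatedAlgebra L →⋆ₐ[ℂ] (W →L[ℂ] W), Continuous χ := fun χ =>
    AddMonoidHomClass.continuous_of_bound χ 1 fun a => by
      rw [one_mul]
      exact NonUnitalStarAlgHom.norm_apply_le χ a
  refine StarAlgHom.ext_topologicalClosure (hcont φ) (hcont ψ)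
    (StarAlgHom.ext_adjoin fun z hz => ?_)
  obtain ⟨f, hf⟩ := hz
  obtain ⟨z, hz'⟩ := z
  obtain rfl : L f = z := hf
  exact h f

/-- The free Fock space representation, read off from the cyclic subspace of a wandering unit
vector. -/
theorem exists_freeFock_representation (hL : IsIsometricFamily L) (hx : IsWandering L x)
    (hx1 : ‖x‖ = 1) :
    ∃ ρ : generatedAlgebra L →⋆ₐ[ℂ] (FreeFock E →L[ℂ] FreeFock E),
      (∀ f, ρ ⟨L f, mem_generatedAlgebra L f⟩ = freeCreation f) ∧
      ∃ U : FreeFock E ≃ₗᵢ[ℂ] cyclicSubspace (generatedAlgebra L) x, ∀ A φ,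
        cyclicRepresentation (generatedAlgebra L) x A (U φ) = U (ρ A φ) := by
  obtain ⟨U, hU⟩ := exists_freeFock_equiv hL hx hx1
  refine ⟨(U.symm.conjStarAlgEquiv : _ →⋆ₐ[ℂ] _).comp (cyclicRepresentation _ x), fun f => ?_, U,
    fun A φ => ?_⟩
  · ext1 φ
    change U.symm (cyclicRepresentation (generatedAlgebra L) x _ (U φ)) = _
    rw [LinearIsometryEquiv.symm_apply_eq]
    exact Subtype.ext (hU f φ).symm
  · change _ = U (U.symm (cyclicRepresentation (generatedAlgebra L) x A (U φ)))
    rw [LinearIsometryEquiv.apply_symm_apply]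

/-- The Wold decomposition: the cyclic subspaces of orthogonal wandering vectors are orthogonal, and
their closed sum is an `L`-invariant subspace containing these vectors. -/
theorem isHilbertSum_cyclicSubspace (hL : IsIsometricFamily L) {D : Set V}
    (hD : ∀ z ∈ D, IsWandering L z) (horth : ∀ z ∈ D, ∀ z' ∈ D, z ≠ z' → inner ℂ z z' = 0)
    (htotal : ∀ M : Submodule ℂ V, IsClosed (M : Set V) → (∀ f, ∀ v ∈ M, L f v ∈ M) → D ⊆ M →
      M = ⊤) :
    IsHilbertSum ℂ (fun z : D => cyclicSubspace (generatedAlgebra L) (z : V))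
      fun z => (cyclicSubspace (generatedAlgebra L) (z : V)).subtypeₗᵢ := by
  refine IsHilbertSum.mkInternal _ (fun z z' hzz' v w => ?_) ?_
  · have h := wordSpan_isOrtho hL (hD z z.2) (hD z' z'.2)
      (horth z z.2 z' z'.2 fun h => hzz' (Subtype.ext h))
    rw [← cyclicSubspace_eq_wordSpan hL (hD z z.2),
      ← cyclicSubspace_eq_wordSpan hL (hD z' z'.2)] at h
    exact h.inner_eq v.2 w.2
  · refine (htotal _ (Submodule.isClosed_topologicalClosure _) (fun f v hv => ?_)
      fun z hz => ?_).ge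
    · refine map_mem_closure (L f).continuous hv fun y hy => ?_
      refine Submodule.iSup_induction 
        (motive := fun y => L f y ∈ ⨆ z : D, cyclicSubspace (generatedAlgebra L) (z : V))
        _ hy (fun z y hy => ?_) ?_ fun a b ha hb => ?_
      · exact Submodule.mem_iSup_of_mem z
          (cyclicSubspace_invariant _ _ ⟨L f, mem_generatedAlgebra L f⟩ y hy)
      · rw [map_zero]
        exact Submodule.zero_mem _
      · rw [map_add]
        exact Submodule.add_mem _ ha hb
    · exact Submodule.le_topologicalClosure _ (Submodule.mem_iSup_of_mem ⟨z, hz⟩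
        (self_mem_cyclicSubspace _ _))

/-- The components of a Hilbert sum of cyclic subspaces intertwine the algebra with the
subrepresentations. -/
theorem linearIsometryEquiv_apply_cyclicRepresentation {C : StarSubalgebra ℂ (V →L[ℂ] V)}
    {D : Set V} (hsum : IsHilbertSum ℂ (fun z : D => cyclicSubspace C (z : V))
      fun z => (cyclicSubspace C (z : V)).subtypeₗᵢ) (A : C) (ξ : V) (z : D) :
    hsum.linearIsometryEquiv ((A : V →L[ℂ] V) ξ) z =
      cyclicRepresentation C z A (hsum.linearIsometryEquiv ξ z) := by
  classical
  have key : ∀ (y : cyclicSubspace C (z : V)) (η : V),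
      inner ℂ y (hsum.linearIsometryEquiv η z) = inner ℂ (y : V) η := fun y η => by
    refine (lp.inner_single_left (𝕜 := ℂ) z y (hsum.linearIsometryEquiv η)).symm.trans ?_
    rw [← hsum.linearIsometryEquiv.symm.inner_map_map,
      hsum.linearIsometryEquiv_symm_apply_single, LinearIsometryEquiv.symm_apply_apply]
    rfl
  refine ext_inner_left ℂ fun y => ?_
  have h := key (cyclicRepresentation C z (star A) y) ξ
  rw [map_star, ContinuousLinearMap.star_eq_adjoint, ContinuousLinearMap.adjoint_inner_left] at h
  rw [key, h, ← ContinuousLinearMap.adjoint_inner_left, ← ContinuousLinearMap.star_eq_adjoint,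
    ← ContinuousLinearMap.star_eq_adjoint, ← map_star]
  rfl

end Wold

/-! ### Symmetric tensors -/

section Sym

variable {E : Type*} [NormedAddCommGroup E] [InnerProductSpace ℂ E]

theorem norm_tprod {n : ℕ} (u : Fin n → E) : ‖tprod u‖ = ∏ i, ‖u i‖ := by
  refine (sq_eq_sq₀ (norm_nonneg _) (Finset.prod_nonneg fun i _ => norm_nonneg _)).1 ?_
  have h := inner_tprod u u
  simp only [inner_self_eq_norm_sq_to_K] at h
  rw [Finset.prod_pow] at h
  refine Complex.ofReal_injective ?_
  push_cast
  exact h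

variable (E) in
/-- Pure tensors in the Hilbert space tensor power, as a continuous multilinear map. -/
def tprodCLM (n : ℕ) : ContinuousMultilinearMap ℂ (fun _ : Fin n => E) (TensorPow E n) :=
  ((UniformSpace.Completion.toComplₗᵢ (𝕜 := ℂ)
    (E := AlgTensorPower E n)).toLinearMap.compMultilinearMap algTprod).mkContinuous 1
      fun u => (norm_tprod u).le.trans (one_mul _).ge

theorem dense_span_tprod_of_dense_span {ι : Type*} (v : ι → E)
    (hv : Dense (Submodule.span ℂ (Set.range v) : Set E)) (n : ℕ) :
    Dense (Submodule.span ℂ (Set.range fun a : Fin n → ι => tprod fun i => v (a i)) :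
      Set (TensorPow E n)) := by
  classical
  set M := (Submodule.span ℂ
    (Set.range fun a : Fin n → ι => tprod fun i => v (a i))).topologicalClosure with hM
  have hMc : IsClosed (M : Set (TensorPow E n)) := Submodule.isClosed_topologicalClosure _
  -- Free the coordinates from the range of `v` one at a time.
  have key : ∀ (s : Finset (Fin n)) (u : Fin n → E), (∀ i ∉ s, u i ∈ Set.range v) →
      tprod u ∈ M := by
    intro s
    induction s using Finset.induction_on with
    | empty =>
      intro u hu
      choose a ha using fun i => hu i (Finset.notMem_empty i)
      obtain rfl : (fun i => v (a i)) = u := funext ha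
      exact Submodule.le_topologicalClosure _ (Submodule.subset_span ⟨a, rfl⟩)
    | insert i s hi ih =>
      intro u hu
      let T : E →L[ℂ] TensorPow E n := (tprodCLM E n).toContinuousLinearMap u i
      have h := mem_of_dense_span hv (M := M.comap T.toLinearMap) (hMc.preimage T.continuous) ?_
        (u i)
      · have h' : tprod (Function.update u i (u i)) ∈ M := h
        rwa [Function.update_eq_self] at h'
      · rintro _ ⟨a, rfl⟩
        refine ih _ fun j hj => ?_
        by_cases hji : j = i
        · subst hji
          simp
        · rw [Function.update_of_ne hji]
          exact hu j (by simp [hji, hj])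
  rw [Submodule.dense_iff_topologicalClosure_eq_top, eq_top_iff, ← hM]
  rintro z -
  refine mem_of_dense_span (dense_span_tprod n) hMc ?_ z
  rintro _ ⟨u, rfl⟩
  exact key Finset.univ u (by simp)

theorem dense_span_symProd_of_dense_span {ι : Type*} (v : ι → E)
    (hv : Dense (Submodule.span ℂ (Set.range v) : Set E)) (n : ℕ) :
    Dense (Submodule.span ℂ (Set.range fun a : Fin n → ι => symProd fun i => v (a i)) :
      Set (SymPow E n)) := by
  set M := (Submodule.span ℂ
    (Set.range fun a : Fin n → ι => symProd fun i => v (a i))).topologicalClosure with hM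
  have hMc : IsClosed (M : Set (SymPow E n)) := Submodule.isClosed_topologicalClosure _
  rw [Submodule.dense_iff_topologicalClosure_eq_top, eq_top_iff, ← hM]
  rintro z -
  let P : TensorPow E n →L[ℂ] SymPow E n := (symSubspace E n).orthogonalProjectionOnto
  have h := mem_of_dense_span (dense_span_tprod_of_dense_span v hv n)
    (M := M.comap P.toLinearMap) (hMc.preimage P.continuous) ?_ (z : TensorPow E n)
  · have h' : P (z : TensorPow E n) ∈ M := h
    rwa [Submodule.orthogonalProjectionOnto_mem_subspace_eq_self] at h'
  · rintro _ ⟨a, rfl⟩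
    change (symSubspace E n).orthogonalProjectionOnto (tprod _) ∈ M
    rw [orthogonalProjectionOnto_tprod]
    exact Submodule.le_topologicalClosure _ (Submodule.subset_span ⟨a, rfl⟩)

theorem toFock_finSymProd {n : ℕ} (u : Fin n → E) :
    (finSymProd u).toFock = lp.single 2 n (symProd u) := by
  simp [FinSymFock.toFock, finSymProd, DirectSum.toModule_lof]

theorem dense_span_toFock_finSymProd {ι : Type*} (v : ι → E)
    (hv : Dense (Submodule.span ℂ (Set.range v) : Set E)) :
    Dense (Submodule.span ℂ (Set.range fun a : Σ n, Fin n → ι =>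
      (finSymProd fun i => v (a.2 i)).toFock) : Set (SymFock E)) := by
  simp only [toFock_finSymProd]
  exact dense_span_lp_single (X := fun n => SymPow E n)
    (fun n (a : Fin n → ι) => symProd fun i => v (a i)) (dense_span_symProd_of_dense_span v hv)

theorem inner_toFock_finSymProd {n : ℕ} (u v : Fin n → E) :
    inner ℂ (finSymProd u).toFock (finSymProd v).toFock = inner ℂ (symProd u) (symProd v) := by
  rw [toFock_finSymProd, toFock_finSymProd, lp.inner_single_left, lp.single_apply_self]

theorem inner_toFock_finSymProd_of_ne {n m : ℕ} (h : n ≠ m) (u : Fin n → E) (v : Fin m → E) :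
    inner ℂ (finSymProd u).toFock (finSymProd v).toFock = 0 := by
  rw [toFock_finSymProd, toFock_finSymProd, lp.inner_single_left, lp.single_apply_ne _ _ _ h,
    inner_zero_right]

theorem finSymProd_perm {n : ℕ} (u : Fin n → E) (s : Equiv.Perm (Fin n)) :
    finSymProd (fun i => u (s i)) = finSymProd u := by
  rw [finSymProd, finSymProd]
  exact congrArg _ (Subtype.ext (symTprod_perm u s))

theorem exists_perm_of_inner_symProd_ne_zero {n : ℕ} {u v : Fin n → E}
    (h : inner ℂ (symProd u) (symProd v) ≠ 0) :
    ∃ s : Equiv.Perm (Fin n), ∀ i, inner ℂ (u i) (v (s i)) ≠ 0 := by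
  rw [inner_symProd] at h
  obtain ⟨s, -, hs⟩ := Finset.exists_ne_zero_of_sum_ne_zero (right_ne_zero_of_mul h)
  exact ⟨s, fun i => Finset.prod_ne_zero_iff.1 hs i (Finset.mem_univ i)⟩

/-- If the first factors cannot be paired with the remaining ones, only the permutations fixing
the first place contribute to the scalar product. The factor `(n + 1)⁻¹` is what the `√(n + 1)` in
the boson creation operator compensates. -/
theorem inner_symProd_cons {n : ℕ} (h h' : E) (u u' : Fin n → E)
    (H : ∀ i j, inner ℂ h (u' j) * inner ℂ (u i) h' = 0) :
    inner ℂ (symProd (Fin.cons h u : Fin (n + 1) → E))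
        (symProd (Fin.cons h' u' : Fin (n + 1) → E)) =
      ((n : ℂ) + 1)⁻¹ * (inner ℂ h h' * inner ℂ (symProd u) (symProd u')) := by
  have hs : ∀ s : Equiv.Perm (Fin n), ∏ i, inner ℂ ((Fin.cons h u : Fin (n + 1) → E) i)
      ((Fin.cons h' u' : Fin (n + 1) → E) (Equiv.Perm.decomposeFin.symm (0, s) i)) =
      inner ℂ h h' * ∏ i, inner ℂ (u i) (u' (s i)) := fun s => by
    simp [Fin.prod_univ_succ]
  have hz : ∀ (q : Fin n) (s : Equiv.Perm (Fin n)),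
      ∏ i, inner ℂ ((Fin.cons h u : Fin (n + 1) → E) i)
        ((Fin.cons h' u' : Fin (n + 1) → E) (Equiv.Perm.decomposeFin.symm (q.succ, s) i)) =
      0 := fun q s => by
    set t := Equiv.Perm.decomposeFin.symm (q.succ, s) with ht
    have h0 : t 0 = q.succ := by simp [ht]
    -- The place mapped to `0` is not `0` itself.
    obtain ⟨r, hr⟩ : ∃ r : Fin n, t r.succ = 0 := by
      obtain ⟨p, hp⟩ := t.surjective 0
      refine Fin.cases (fun hp => ?_) (fun r hp => ⟨r, hp⟩) p hp
      rw [h0] at hp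
      exact absurd hp (Fin.succ_ne_zero q)
    rcases mul_eq_zero.1 (H r q) with h1 | h1
    · exact Finset.prod_eq_zero (Finset.mem_univ 0) (by simpa [h0] using h1)
    · exact Finset.prod_eq_zero (Finset.mem_univ r.succ) (by simpa [hr] using h1)
  rw [inner_symProd, inner_symProd, ← Equiv.sum_comp Equiv.Perm.decomposeFin.symm,
    Fintype.sum_prod_type, Fin.sum_univ_succ]
  simp only [hs, hz, Finset.sum_const_zero, add_zero, ← Finset.mul_sum, Nat.factorial_succ,
    Nat.cast_mul, mul_inv, Nat.cast_add, Nat.cast_one]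
  ring

end Sym

/-! ### Coloured one-particle vectors -/

section Coloured
open MeasureTheory

variable {G : Type*} [NormedAddCommGroup G] [InnerProductSpace ℂ G]

theorem coeFn_elemTensor (f : OneParticle) (g : G) :
    elemTensor f g =ᵐ[halfLine] fun t => f t • g := by
  filter_upwards [ContinuousLinearMap.coeFn_compLp (ContinuousLinearMap.toSpanSingleton ℂ g) f]
    with t ht
  rw [elemTensor, ht, ContinuousLinearMap.toSpanSingleton_apply]

theorem inner_elemTensor_left (f : OneParticle) (g : G) (h : ColouredParticle G) :
    inner ℂ (elemTensor f g) h = inner ℂ f ((innerSL ℂ g).compLp h) := by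
  rw [L2.inner_def, L2.inner_def]
  refine integral_congr_ae ?_
  filter_upwards [coeFn_elemTensor f g, ContinuousLinearMap.coeFn_compLp (innerSL ℂ g) h]
    with t h1 h2
  rw [h1, h2, inner_smul_left]
  simp [mul_comm]

theorem inner_elemTensor (f f' : OneParticle) (g g' : G) :
    inner ℂ (elemTensor f g) (elemTensor f' g') = inner ℂ f f' * inner ℂ g g' := by
  rw [L2.inner_def, L2.inner_def, ← integral_mul_const]
  refine integral_congr_ae ?_
  filter_upwards [coeFn_elemTensor f g, coeFn_elemTensor f' g'] with t h1 h2
  rw [h1, h2, inner_smul_left, inner_smul_right]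
  simp
  ring

theorem dense_span_elemTensor [CompleteSpace G] (e : HilbertBasis ℕ ℂ G)
    (d : HilbertBasis ℕ ℂ OneParticle) :
    Dense (Submodule.span ℂ (Set.range fun p : ℕ × ℕ => elemTensor (d p.1) (e p.2)) :
      Set (ColouredParticle G)) := by
  rw [Submodule.dense_iff_topologicalClosure_eq_top, Submodule.topologicalClosure_eq_top_iff,
    eq_bot_iff]
  intro h hh
  rw [Submodule.mem_orthogonal] at hh
  have h1 : ∀ k, (innerSL ℂ (e k)).compLp h = 0 := fun k => by
    refine d.repr.injective (lp.ext (funext fun i => ?_))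
    rw [d.repr_apply_apply, ← inner_elemTensor_left, map_zero]
    exact hh _ (Submodule.subset_span ⟨(i, k), rfl⟩)
  have h2 : ∀ᵐ t ∂halfLine, ∀ k, inner ℂ (e k) (h t) = 0 := by
    rw [ae_all_iff]
    intro k
    have h3 := ContinuousLinearMap.coeFn_compLp (innerSL ℂ (e k)) h
    rw [h1 k] at h3
    filter_upwards [h3, Lp.coeFn_zero ℂ 2 halfLine] with t ht ht'
    rw [ht'] at ht
    simpa using ht.symm
  refine (Submodule.mem_bot ℂ).2 ((Lp.eq_zero_iff_ae_eq_zero).2 ?_)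
  filter_upwards [h2] with t ht
  refine e.repr.injective (lp.ext (funext fun k => ?_))
  rw [e.repr_apply_apply, ht k]
  simp

variable (e : HilbertBasis ℕ ℂ G)

theorem inner_elemTensor_basis (f f' : OneParticle) (k k' : ℕ) :
    inner ℂ (elemTensor f (e k)) (elemTensor f' (e k')) =
      if k = k' then inner ℂ f f' else 0 := by
  rw [inner_elemTensor, orthonormal_iff_ite.1 e.orthonormal]
  split_ifs <;> simp

theorem colourProjection_elemTensor [CompleteSpace G] (r : ℕ) (f : OneParticle) (k : ℕ) :
    colourProjection e {j | j < r} (elemTensor f (e k)) =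
      if k < r then elemTensor f (e k) else 0 := by
  rw [colourProjection]
  split_ifs with h
  · rw [Submodule.starProjection_eq_self_iff]
    exact Submodule.le_topologicalClosure _ (Submodule.subset_span ⟨f, k, h, rfl⟩)
  · rw [Submodule.starProjection_apply_eq_zero_iff, colourSubspace, Submodule.orthogonal_closure,
      Submodule.mem_orthogonal]
    intro w hw
    induction hw using Submodule.span_induction with
    | mem w hw =>
      obtain ⟨f', k', hk', rfl⟩ := hw
      rw [inner_elemTensor_basis, if_neg]
      rintro rfl
      exact h hk'
    | zero => exact inner_zero_left _
    | add x y _ _ hx hy => rw [inner_add_left, hx, hy, add_zero]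
    | smul c x _ hx => rw [inner_smul_left, hx, mul_zero]

end Coloured

/-! ### The extended free creation operators -/

section Creation
open Filter Topology

/-- The first colour index above all those occurring in `k`; it is `0` for the vacuum. -/
def nextColour {n : ℕ} (k : Fin n → ℕ) : ℕ :=
  Finset.univ.sup fun i => k i + 1

theorem nextColour_le_iff {n : ℕ} {k : Fin n → ℕ} {r : ℕ} :
    nextColour k ≤ r ↔ ∀ i, k i < r := by
  simp [nextColour]

theorem lt_nextColour {n : ℕ} (k : Fin n → ℕ) (i : Fin n) : k i < nextColour k :=
  nextColour_le_iff.1 le_rfl i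

theorem nextColour_comp_perm {n : ℕ} (k : Fin n → ℕ) (s : Equiv.Perm (Fin n)) :
    nextColour (fun i => k (s i)) = nextColour k :=
  le_antisymm (nextColour_le_iff.2 fun _ => lt_nextColour k _)
    (nextColour_le_iff.2 fun i => by simpa using lt_nextColour (fun i => k (s i)) (s.symm i))

variable {G : Type*} [NormedAddCommGroup G] [InnerProductSpace ℂ G]
  (e : HilbertBasis ℕ ℂ G)

/-- The vector `(g₁ ⊗ e_{k₁}) ∘ ⋯ ∘ (gₙ ⊗ e_{kₙ})` of the symmetric Fock space. -/
def colourVector {n : ℕ} (g : Fin n → OneParticle) (k : Fin n → ℕ) :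
    SymFock (ColouredParticle G) :=
  (finSymProd fun i => elemTensor (g i) (e (k i))).toFock

/-- The image of a product vector under the extended free creation operator: a new particle is
added whose colour is the successor of the largest colour present. -/
def creationVector (f : OneParticle) {n : ℕ} (g : Fin n → OneParticle) (k : Fin n → ℕ) :
    SymFock (ColouredParticle G) :=
  (Real.sqrt (n + 1) : ℂ) • colourVector e (Fin.cons f g : Fin (n + 1) → OneParticle)
    (Fin.cons (nextColour k) k : Fin (n + 1) → ℕ)

theorem elemTensor_cons (f : OneParticle) (j : ℕ) {n : ℕ} (g : Fin n → OneParticle)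
    (k : Fin n → ℕ) :
    (fun i => elemTensor ((Fin.cons f g : Fin (n + 1) → OneParticle) i)
      (e ((Fin.cons j k : Fin (n + 1) → ℕ) i))) =
    (Fin.cons (elemTensor f (e j)) fun i => elemTensor (g i) (e (k i)) :
      Fin (n + 1) → ColouredParticle G) := by
  funext i
  refine Fin.cases ?_ (fun i => ?_) i <;> simp

theorem inner_colourVector {n : ℕ} (g g' : Fin n → OneParticle) (k k' : Fin n → ℕ) :
    inner ℂ (colourVector e g k) (colourVector e g' k') =
      inner ℂ (symProd fun i => elemTensor (g i) (e (k i)))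
        (symProd fun i => elemTensor (g' i) (e (k' i))) :=
  inner_toFock_finSymProd _ _

theorem exists_perm_of_inner_colourVector_ne_zero {n : ℕ} {g g' : Fin n → OneParticle}
    {k k' : Fin n → ℕ} (h : inner ℂ (colourVector e g k) (colourVector e g' k') ≠ 0) :
    ∃ s : Equiv.Perm (Fin n), ∀ i, k i = k' (s i) ∧ inner ℂ (g i) (g' (s i)) ≠ 0 := by
  rw [inner_colourVector] at h
  obtain ⟨s, hs⟩ := exists_perm_of_inner_symProd_ne_zero h
  refine ⟨s, fun i => ?_⟩
  simpa [inner_elemTensor_basis] using hs i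

theorem inner_creationVector (f f' : OneParticle) {n n' : ℕ} (g : Fin n → OneParticle)
    (k : Fin n → ℕ) (g' : Fin n' → OneParticle) (k' : Fin n' → ℕ) :
    inner ℂ (creationVector e f g k) (creationVector e f' g' k') =
      inner ℂ f f' * inner ℂ (colourVector e g k) (colourVector e g' k') := by
  by_cases hn : n = n'
  · subst hn
    have hsqrt : (Real.sqrt (n + 1) : ℂ) * Real.sqrt (n + 1) = n + 1 := by
      rw [← Complex.ofReal_mul, Real.mul_self_sqrt (by positivity)]
      push_cast
      rfl
    have hne : (n : ℂ) + 1 ≠ 0 := Nat.cast_add_one_ne_zero n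
    rw [creationVector, creationVector, inner_smul_left, inner_smul_right, inner_colourVector,
      inner_colourVector, elemTensor_cons, elemTensor_cons, inner_symProd_cons,
      inner_elemTensor_basis, Complex.conj_ofReal, ← mul_assoc, ← mul_assoc, hsqrt,
      mul_inv_cancel₀ hne, one_mul]
    · split_ifs with hk
      · rfl
      · rw [zero_mul, eq_comm, ← inner_colourVector]
        by_contra h
        obtain ⟨s, hs⟩ := exists_perm_of_inner_colourVector_ne_zero e (right_ne_zero_of_mul h)
        refine hk ?_
        rw [← nextColour_comp_perm k' s]
        exact congrArg nextColour (funext fun i => (hs i).1)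
    · intro i j
      rw [inner_elemTensor_basis, inner_elemTensor_basis]
      -- A nonzero product would put each new colour below the other one.
      split_ifs with h1 h2
      · have h3 := lt_nextColour k i
        have h4 := lt_nextColour k' j
        omega
      all_goals simp
  · rw [creationVector, creationVector, inner_smul_left, inner_smul_right, colourVector,
      colourVector, inner_toFock_finSymProd_of_ne (by omega), colourVector, colourVector,
      inner_toFock_finSymProd_of_ne hn]
    simp

variable [CompleteSpace G]

theorem initialCreation_finSymProd (r : ℕ) (h : ColouredParticle G) {n : ℕ}
    (g : Fin n → OneParticle) (k : Fin n → ℕ) :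
    initialCreation e r h (finSymProd fun i => elemTensor (g i) (e (k i))) =
      if nextColour k < r then (Real.sqrt (n + 1) : ℂ) •
        finSymProd (Fin.cons h fun i => elemTensor (g i) (e (k i)) : Fin (n + 1) → _)
      else 0 := by
  cases r with
  | zero => simp [initialCreation]
  | succ r =>
    have h1 : initialCreation e (r + 1) h (finSymProd fun i => elemTensor (g i) (e (k i))) =
        (Real.sqrt (n + 1) : ℂ) • finSymProd (Fin.cons h fun i =>
          if k i < r then elemTensor (g i) (e (k i)) else 0 : Fin (n + 1) → _) := by
      simp only [initialCreation, filteredCreation, LinearMap.comp_apply, secondQuantization,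
        finSymProd, DirectSum.lmap_lof, bosonCreation, DirectSum.toModule_lof,
        ContinuousLinearMap.coe_coe, symMap_symProd, colourProjection_elemTensor, symLeft_symProd,
        map_smul]
    rw [h1]
    split_ifs with hk
    · rw [Nat.lt_succ_iff, nextColour_le_iff] at hk
      simp only [hk, if_true]
    · rw [Nat.lt_succ_iff, nextColour_le_iff] at hk
      push Not at hk
      obtain ⟨i, hi⟩ := hk
      have hzero : symProd (Fin.cons h fun i =>
          if k i < r then elemTensor (g i) (e (k i)) else 0 :
            Fin (n + 1) → ColouredParticle G) = 0 := by
        refine inner_self_eq_zero.1 ((inner_symProd _ _).trans ?_)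
        refine mul_eq_zero_of_right _ (Finset.sum_eq_zero fun s _ =>
          Finset.prod_eq_zero (Finset.mem_univ i.succ) ?_)
        simp [not_lt.2 hi]
      rw [finSymProd, hzero, map_zero, smul_zero]

theorem mFreeCreation_finSymProd {m : ℕ} (f : OneParticle) {n : ℕ} (g : Fin n → OneParticle)
    (k : Fin n → ℕ) (hm : nextColour k < m) :
    (mFreeCreation e m f (finSymProd fun i => elemTensor (g i) (e (k i)))).toFock =
      creationVector e f g k := by
  rw [mFreeCreation, LinearMap.sum_apply, Finset.sum_eq_single (nextColour k)]
  · rw [LinearMap.sub_apply, initialCreation_finSymProd, initialCreation_finSymProd,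
      if_pos (Nat.lt_succ_self _), if_neg (lt_irrefl _), sub_zero, map_smul, creationVector,
      colourVector, elemTensor_cons]
  · intro j _ hj
    rw [LinearMap.sub_apply, initialCreation_finSymProd, initialCreation_finSymProd]
    rcases lt_or_gt_of_ne hj with h | h
    · rw [if_neg (by omega), if_neg (by omega), sub_zero]
    · rw [if_pos (by omega), if_pos h, sub_self]
  · intro h
    exact absurd (Finset.mem_range.2 hm) h

theorem isExtendedFreeCreation_iff (f : OneParticle)
    (T : SymFock (ColouredParticle G) →L[ℂ] SymFock (ColouredParticle G)) :
    IsExtendedFreeCreation e f T ↔ ∀ (n : ℕ) (g : Fin n → OneParticle) (k : Fin n → ℕ),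
      T (colourVector e g k) = creationVector e f g k := by
  refine forall_congr' fun n => forall_congr' fun g => forall_congr' fun k => ?_
  have hev : ∀ᶠ m in atTop, (mFreeCreation e m f
      (finSymProd fun i => elemTensor (g i) (e (k i)))).toFock = creationVector e f g k := by
    filter_upwards [eventually_gt_atTop (nextColour k)] with m hm
    exact mFreeCreation_finSymProd e f g k hm
  have hlim := tendsto_const_nhds.congr' (EventuallyEq.symm hev)
  exact ⟨fun h => tendsto_nhds_unique h hlim, fun h => by rw [← h] at hlim; exact hlim⟩

theorem dense_span_basisVector (d : HilbertBasis ℕ ℂ OneParticle) :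
    Dense (Submodule.span ℂ (Set.range fun a : Σ n, (Fin n → ℕ) × (Fin n → ℕ) =>
      basisVector e d a.2.1 a.2.2) : Set (SymFock (ColouredParticle G))) := by
  refine (dense_span_toFock_finSymProd _ (dense_span_elemTensor e d)).mono
    (Submodule.span_mono ?_)
  rintro _ ⟨⟨n, a⟩, rfl⟩
  exact ⟨⟨n, fun r => (a r).1, fun r => (a r).2⟩, rfl⟩

theorem dense_span_colourVector (d : HilbertBasis ℕ ℂ OneParticle) :
    Dense (Submodule.span ℂ (Set.range fun a : Σ n, (Fin n → OneParticle) × (Fin n → ℕ) =>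
      colourVector e a.2.1 a.2.2) : Set (SymFock (ColouredParticle G))) := by
  refine (dense_span_basisVector e d).mono (Submodule.span_mono ?_)
  rintro _ ⟨⟨n, i, k⟩, rfl⟩
  exact ⟨⟨n, fun r => d (i r), k⟩, rfl⟩

theorem exists_extendedFreeCreation (d : HilbertBasis ℕ ℂ OneParticle) (f : OneParticle) :
    ∃ T : SymFock (ColouredParticle G) →L[ℂ] SymFock (ColouredParticle G),
      ∀ (n : ℕ) (g : Fin n → OneParticle) (k : Fin n → ℕ),
        T (colourVector e g k) = creationVector e f g k := by
  obtain ⟨T, hT⟩ := exists_continuousLinearMap_of_inner_eq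
    (fun a : Σ n, (Fin n → OneParticle) × (Fin n → ℕ) => colourVector e a.2.1 a.2.2)
    (fun a => creationVector e f a.2.1 a.2.2) (dense_span_colourVector e d) ‖f‖ (norm_nonneg f)
    fun a b => by
      rw [inner_creationVector, inner_self_eq_norm_sq_to_K]
      rfl
  exact ⟨T, fun n g k => hT ⟨n, g, k⟩⟩

theorem isIsometricFamily_of_apply_colourVector (d : HilbertBasis ℕ ℂ OneParticle)
    {L : OneParticle → SymFock (ColouredParticle G) →L[ℂ] SymFock (ColouredParticle G)}
    (hL : ∀ f (n : ℕ) (g : Fin n → OneParticle) (k : Fin n → ℕ),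
      L f (colourVector e g k) = creationVector e f g k) : IsIsometricFamily L := by
  intro f f'
  refine inner_map_map_of_dense_span (dense_span_colourVector e d) (L f) (L f') _ ?_
  rintro _ ⟨a, rfl⟩ _ ⟨b, rfl⟩
  rw [hL, hL, inner_creationVector]

end Creation

/-! ### The defect vectors -/

section Defect

variable {G : Type*} [NormedAddCommGroup G] [InnerProductSpace ℂ G]
  (e : HilbertBasis ℕ ℂ G) (d : HilbertBasis ℕ ℂ OneParticle)

theorem basisVector_eq_colourVector {n : ℕ} (i k : Fin n → ℕ) :
    basisVector e d i k = colourVector e (fun r => d (i r)) k :=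
  rfl

theorem basisVector_perm {n : ℕ} (i k : Fin n → ℕ) (s : Equiv.Perm (Fin n)) :
    basisVector e d (fun r => i (s r)) (fun r => k (s r)) = basisVector e d i k :=
  congrArg FinSymFock.toFock (finSymProd_perm (fun r => elemTensor (d (i r)) (e (k r))) s)

theorem basisVector_ne_zero {n : ℕ} (i k : Fin n → ℕ) : basisVector e d i k ≠ 0 := by
  intro h
  have h1 : inner ℂ (basisVector e d i k) (basisVector e d i k) = 0 := by rw [h, inner_zero_left]
  rw [basisVector_eq_colourVector, inner_colourVector, inner_symProd] at h1
  have hterm : ∀ s : Equiv.Perm (Fin n), ∏ r, inner ℂ (elemTensor (d (i r)) (e (k r)))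
      (elemTensor (d (i (s r))) (e (k (s r)))) =
      if ∀ r, k r = k (s r) ∧ i r = i (s r) then (1 : ℂ) else 0 := fun s => by
    have h2 : ∀ r, inner ℂ (elemTensor (d (i r)) (e (k r)))
        (elemTensor (d (i (s r))) (e (k (s r)))) =
        if k r = k (s r) ∧ i r = i (s r) then (1 : ℂ) else 0 := fun r => by
      rw [inner_elemTensor_basis, orthonormal_iff_ite.1 d.orthonormal, ite_and]
    simp only [h2, Finset.prod_ite_zero, Finset.mem_univ, true_imp_iff, Finset.prod_const_one]
  simp only [hterm, Finset.sum_boole] at h1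
  rcases mul_eq_zero.1 h1 with h2 | h2
  · exact Nat.factorial_ne_zero n (by exact_mod_cast inv_eq_zero.1 h2)
  · rw [Nat.cast_eq_zero, Finset.card_eq_zero] at h2
    have h3 : (1 : Equiv.Perm (Fin n)) ∈ Finset.univ.filter fun s : Equiv.Perm (Fin n) =>
        ∀ r, k r = k (s r) ∧ i r = i (s r) := by simp
    rw [h2] at h3
    exact Finset.notMem_empty _ h3

theorem monotone_toLex_iff {n : ℕ} {i k : Fin n → ℕ} :
    Monotone (fun r => toLex (k r, i r)) ↔
      Monotone k ∧ ∀ r s, r ≤ s → k r = k s → i r ≤ i s := by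
  simp only [Monotone, Prod.Lex.toLex_le_toLex]
  constructor
  · intro h
    refine ⟨fun r s hrs => ?_, fun r s hrs hk => ?_⟩
    · have := h hrs
      omega
    · have := h hrs
      omega
  · intro h r s hrs
    have h1 := h.1 hrs
    have h2 := h.2 r s hrs
    omega

/-- A nonzero scalar product matches the index data up to a permutation, and sorting by colour and
then by `d`-index singles out one representative of each multiset. -/
theorem inner_basisVector_eq_zero {n : ℕ} {i k i' k' : Fin n → ℕ}
    (h : Monotone fun r => toLex (k r, i r)) (h' : Monotone fun r => toLex (k' r, i' r))
    (hne : ¬(i = i' ∧ k = k')) :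
    inner ℂ (basisVector e d i k) (basisVector e d i' k') = 0 := by
  by_contra hin
  rw [basisVector_eq_colourVector, basisVector_eq_colourVector] at hin
  obtain ⟨s, hs⟩ := exists_perm_of_inner_colourVector_ne_zero e hin
  have hi : ∀ r, i r = i' (s r) := fun r => by
    by_contra hr
    exact (hs r).2 (d.orthonormal.2 hr)
  have heq : (fun r => toLex (k r, i r)) = (fun r => toLex (k' r, i' r)) ∘ s :=
    funext fun r => by simp [hi, (hs r).1]
  have h1 := Tuple.unique_monotone (f := fun r => toLex (k' r, i' r)) (σ := s) (τ := 1)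
    (heq ▸ h) (by simpa using h')
  rw [← heq] at h1
  have h2 : ∀ r, k r = k' r ∧ i r = i' r := fun r => by
    simpa [Prod.ext_iff] using congrFun h1 r
  exact hne ⟨funext fun r => (h2 r).2, funext fun r => (h2 r).1⟩

theorem defectVectors_nonempty : (defectVectors e d).Nonempty :=
  ⟨_, 0, Fin.elim0, Fin.elim0, ⟨fun r => r.elim0, fun r => r.elim0, fun r => r.elim0,
    fun r => r.elim0⟩, rfl⟩

theorem norm_of_mem_defectVectors {x : SymFock (ColouredParticle G)}
    (hx : x ∈ defectVectors e d) : ‖x‖ = 1 := by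
  obtain ⟨n, i, k, -, rfl⟩ := hx
  exact norm_smul_inv_norm (𝕜 := ℂ) (basisVector_ne_zero e d i k)

theorem inner_of_mem_defectVectors {x y : SymFock (ColouredParticle G)}
    (hx : x ∈ defectVectors e d) (hy : y ∈ defectVectors e d) (hxy : x ≠ y) :
    inner ℂ x y = 0 := by
  obtain ⟨n, i, k, h, rfl⟩ := hx
  obtain ⟨n', i', k', h', rfl⟩ := hy
  rw [inner_smul_left, inner_smul_right]
  by_cases hn : n = n'
  · subst hn
    rw [inner_basisVector_eq_zero e d (monotone_toLex_iff.2 ⟨h.colour_mono, h.index_mono⟩)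
      (monotone_toLex_iff.2 ⟨h'.colour_mono, h'.index_mono⟩), mul_zero, mul_zero]
    rintro ⟨rfl, rfl⟩
    exact hxy rfl
  · rw [basisVector, basisVector, inner_toFock_finSymProd_of_ne hn, mul_zero, mul_zero]

/-- In the range of an extended free creation operator the largest colour occurs once, and it is
the successor of the second largest one; this is what admissible index data exclude. -/
theorem not_colours_eq_cons_nextColour {n m : ℕ} {i k : Fin m → ℕ} (h : IsDefectIndex i k)
    (hm : n + 1 = m) (k' : Fin n → ℕ) (s : Fin (n + 1) ≃ Fin m)
    (hs : ∀ r, (Fin.cons (nextColour k') k' : Fin (n + 1) → ℕ) r = k (s r)) : False := by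
  subst hm
  have h0 : nextColour k' = k (s 0) := hs 0
  have hsucc : ∀ r : Fin n, k' r = k (s r.succ) := fun r => by simpa using hs r.succ
  have hlt : ∀ q, q ≠ s 0 → k q < k (s 0) := fun q hq => by
    obtain ⟨p, rfl⟩ := s.surjective q
    obtain ⟨r, rfl⟩ := Fin.exists_succ_eq.2 (fun hp : p = 0 => hq (by rw [hp]))
    rw [← hsucc, ← h0]
    exact lt_nextColour k' r
  have hlast : s 0 = Fin.last n := by
    by_contra hq
    exact absurd (h.colour_mono (Fin.le_last (s 0))) (not_le.2 (hlt _ (Ne.symm hq)))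
  cases n with
  | zero => exact h.single (s 0) rfl (by rw [← h0]; simp [nextColour])
  | succ n =>
    have h1 := h.last (Fin.last n).castSucc (Fin.last (n + 1)) (by simp) (by simp)
    have h2 : k (Fin.last n).castSucc < k (s 0) :=
      hlt _ (by rw [hlast]; exact (Fin.castSucc_lt_last _).ne)
    have h3 : nextColour k' ≤ k (Fin.last n).castSucc + 1 := nextColour_le_iff.2 fun r => by
      rw [hsucc, Nat.lt_succ_iff]
      refine h.colour_mono ?_
      have h4 : s r.succ ≠ Fin.last (n + 1) := fun h5 =>
        Fin.succ_ne_zero r (s.injective (h5.trans hlast.symm))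
      have h5 := Fin.val_lt_last h4
      rw [Fin.le_def]
      simp
      omega
    rw [hlast] at h0 h2
    omega

variable {e d}
  {L : OneParticle → SymFock (ColouredParticle G) →L[ℂ] SymFock (ColouredParticle G)}
  (hL : ∀ f (n : ℕ) (g : Fin n → OneParticle) (k : Fin n → ℕ),
    L f (colourVector e g k) = creationVector e f g k)
include hL

/-- If the last colour is the first one above all others, the basis vector is obtained from a
shorter one by an extended free creation operator. -/
theorem apply_basisVector_init {n : ℕ} (i k : Fin (n + 1) → ℕ)
    (hk : k (Fin.last n) = nextColour fun r : Fin n => k r.castSucc) :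
    L (d (i (Fin.last n))) (basisVector e d (fun r : Fin n => i r.castSucc) fun r => k r.castSucc) =
      (Real.sqrt (n + 1) : ℂ) • basisVector e d i k := by
  rw [basisVector_eq_colourVector, hL, creationVector, ← hk, basisVector_eq_colourVector,
    colourVector, colourVector]
  congr 2
  rw [← finSymProd_perm _ (finRotate (n + 1))]
  congr 1
  funext r
  have hi : (Fin.cons (d (i (Fin.last n))) (fun r : Fin n => d (i r.castSucc)) :
      Fin (n + 1) → OneParticle) (finRotate (n + 1) r) = d (i r) := by
    rw [← congrFun (Fin.snoc_eq_cons_rotate _ _) r]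
    exact congrFun (Fin.snoc_init_self fun r => d (i r)) r
  have hk' : (Fin.cons (k (Fin.last n)) (fun r : Fin n => k r.castSucc) :
      Fin (n + 1) → ℕ) (finRotate (n + 1) r) = k r := by
    rw [← congrFun (Fin.snoc_eq_cons_rotate _ _) r]
    exact congrFun (Fin.snoc_init_self k) r
  rw [hi, hk']

theorem basisVector_mem_of_monotone {M : Submodule ℂ (SymFock (ColouredParticle G))}
    (hM : ∀ f, ∀ v ∈ M, L f v ∈ M) (hD : defectVectors e d ⊆ M) {n : ℕ} (i k : Fin n → ℕ)
    (h : Monotone fun r => toLex (k r, i r)) : basisVector e d i k ∈ M := by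
  -- A vector obtained by creation reduces to a shorter sorted one.
  have step : ∀ {n : ℕ}, (∀ i k : Fin n → ℕ, (Monotone fun r => toLex (k r, i r)) →
      basisVector e d i k ∈ M) → ∀ i k : Fin (n + 1) → ℕ, (Monotone fun r => toLex (k r, i r)) →
      k (Fin.last n) = nextColour (fun r : Fin n => k r.castSucc) → basisVector e d i k ∈ M := by
    intro n ih i k h hk
    have h1 := hM (d (i (Fin.last n))) _ (ih (fun r => i r.castSucc) (fun r => k r.castSucc)
      fun r s hrs => h (Fin.castSucc_le_castSucc_iff.2 hrs))
    rw [apply_basisVector_init hL i k hk] at h1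
    refine (M.smul_mem_iff ?_).1 h1
    exact_mod_cast (Real.sqrt_pos.2 (by positivity : (0 : ℝ) < n + 1)).ne'
  induction n with
  | zero => ?_
  | succ n ih => ?_
  all_goals
    by_cases hdef : IsDefectIndex i k
    · refine (M.smul_mem_iff (s := ((‖basisVector e d i k‖ : ℂ)⁻¹)) ?_).1 (hD ⟨_, i, k, hdef, rfl⟩)
      simpa using basisVector_ne_zero e d i k
  · exact absurd ⟨fun r => r.elim0, fun r => r.elim0, fun r => r.elim0, fun r => r.elim0⟩ hdef
  · obtain ⟨hk, hi⟩ := monotone_toLex_iff.1 h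
    refine step ih i k h ?_
    by_contra hne
    refine hdef ⟨hk, hi, ?_, ?_⟩
    · intro r hn hr
      obtain rfl : n = 0 := by omega
      refine hne ?_
      rw [Subsingleton.elim (α := Fin 1) (Fin.last 0) r, hr]
      simp [nextColour]
    · intro r s hs hr hks
      obtain rfl : s = Fin.last n := Fin.ext (by simpa using hs)
      refine hne (le_antisymm ?_ (nextColour_le_iff.2 fun q => ?_))
      · rw [hks]
        have hrn : (r : ℕ) < n := by simp at hr; omega
        exact lt_nextColour (fun r : Fin n => k r.castSucc) ⟨r, hrn⟩
      · rw [hks, Nat.lt_succ_iff]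
        refine hk ?_
        rw [Fin.le_def]
        simp at hr ⊢
        omega

variable [CompleteSpace G]

theorem isWandering_of_mem_defectVectors {x : SymFock (ColouredParticle G)}
    (hx : x ∈ defectVectors e d) : IsWandering L x := by
  obtain ⟨m, i, k, h, rfl⟩ := hx
  intro f v
  have hzero : (innerSL ℂ (basisVector e d i k)) ∘L L f = 0 := by
    refine ContinuousLinearMap.ext_on (dense_span_colourVector e d) ?_
    rintro _ ⟨⟨n, g, k'⟩, rfl⟩
    change inner ℂ (basisVector e d i k) (L f (colourVector e g k')) = 0
    rw [hL, creationVector, inner_smul_right, ← inner_conj_symm]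
    refine mul_eq_zero_of_right _ ?_
    rw [map_eq_zero]
    by_cases hm : n + 1 = m
    · by_contra hin
      subst hm
      obtain ⟨s, hs⟩ := exists_perm_of_inner_colourVector_ne_zero e hin
      exact not_colours_eq_cons_nextColour h rfl k' s fun r => (hs r).1
    · exact inner_toFock_finSymProd_of_ne hm _ _
  rw [inner_smul_right, ← inner_conj_symm]
  have h1 : inner ℂ (basisVector e d i k) (L f v) = 0 := DFunLike.congr_fun hzero v
  rw [h1, map_zero, mul_zero]

theorem eq_top_of_defectVectors_subset {M : Submodule ℂ (SymFock (ColouredParticle G))}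
    (hMc : IsClosed (M : Set (SymFock (ColouredParticle G)))) (hM : ∀ f, ∀ v ∈ M, L f v ∈ M)
    (hD : defectVectors e d ⊆ M) : M = ⊤ := by
  rw [eq_top_iff]
  rintro ξ -
  refine mem_of_dense_span (dense_span_basisVector e d) hMc ?_ ξ
  rintro _ ⟨⟨n, i, k⟩, rfl⟩
  change basisVector e d i k ∈ M
  rw [← basisVector_perm e d i k (Tuple.sort fun r => toLex (k r, i r))]
  exact basisVector_mem_of_monotone hL hM hD _ _ (Tuple.monotone_sort fun r => toLex (k r, i r))

end Defect

end
end FilteredFock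

/-! ### The decomposition -/

set_option maxHeartbeats 600000 in
theorem theorem9p8 {G : Type*} [NormedAddCommGroup G] [InnerProductSpace ℂ G] [CompleteSpace G]
    (e : HilbertBasis ℕ ℂ G) (d : HilbertBasis ℕ ℂ FilteredFock.OneParticle) :
    ∃ L : FilteredFock.OneParticle →
        (FilteredFock.SymFock (FilteredFock.ColouredParticle G) →L[ℂ]
          FilteredFock.SymFock (FilteredFock.ColouredParticle G)),
      -- `L f` is the extended free creation operator: the unique bounded extension
      (∀ f T, FilteredFock.IsExtendedFreeCreation e f T ↔ T = L f) ∧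
      -- the space is the Hilbert sum of the `[C x]`, and the identity representation
      -- of `C` is the direct sum of the `π_x`
      (∃ hsum : IsHilbertSum ℂ
          (fun x : FilteredFock.defectVectors e d =>
            FilteredFock.cyclicSubspace (FilteredFock.generatedAlgebra L) (x : _))
          (fun x => (FilteredFock.cyclicSubspace
            (FilteredFock.generatedAlgebra L) (x : _)).subtypeₗᵢ),
        ∀ (A : FilteredFock.generatedAlgebra L)
          (ξ : FilteredFock.SymFock (FilteredFock.ColouredParticle G))
          (x : FilteredFock.defectVectors e d),
          hsum.linearIsometryEquiv ((A : FilteredFock.SymFock (FilteredFock.ColouredParticle G) →L[ℂ]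
              FilteredFock.SymFock (FilteredFock.ColouredParticle G)) ξ) x =
            FilteredFock.cyclicRepresentation (FilteredFock.generatedAlgebra L) x A
              (hsum.linearIsometryEquiv ξ x)) ∧
      -- each `π_x` is unitarily equivalent to the free Fock space representation
      ∃ ρ : FilteredFock.generatedAlgebra L →⋆ₐ[ℂ]
          (FilteredFock.FreeFock FilteredFock.OneParticle →L[ℂ]
            FilteredFock.FreeFock FilteredFock.OneParticle),
        (∀ ρ', FilteredFock.IsFreeFockRepresentation L ρ' ↔ ρ' = ρ) ∧
        ∀ x : FilteredFock.defectVectors e d,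
          ∃ U : FilteredFock.FreeFock FilteredFock.OneParticle ≃ₗᵢ[ℂ]
              FilteredFock.cyclicSubspace (FilteredFock.generatedAlgebra L) (x : _),
            ∀ (A : FilteredFock.generatedAlgebra L)
              (φ : FilteredFock.FreeFock FilteredFock.OneParticle),
              FilteredFock.cyclicRepresentation (FilteredFock.generatedAlgebra L) x A (U φ) =
                U (ρ A φ) := by
  choose L hL using fun f => FilteredFock.exists_extendedFreeCreation e d f
  have hiso := FilteredFock.isIsometricFamily_of_apply_colourVector e d hL
  have hwand := fun x hx => FilteredFock.isWandering_of_mem_defectVectors (e := e) (d := d) hL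
    (x := x) hx
  have hsum := FilteredFock.isHilbertSum_cyclicSubspace hiso hwand
    (fun x hx y hy => FilteredFock.inner_of_mem_defectVectors e d hx hy)
    fun M hMc hM hD => FilteredFock.eq_top_of_defectVectors_subset hL hMc hM hD
  obtain ⟨x₀, hx₀⟩ := FilteredFock.defectVectors_nonempty e d
  obtain ⟨ρ, hρ, -⟩ := FilteredFock.exists_freeFock_representation hiso (hwand x₀ hx₀)
    (FilteredFock.norm_of_mem_defectVectors e d hx₀)
  refine ⟨L, fun f T => ?_, ⟨hsum,
    FilteredFock.linearIsometryEquiv_apply_cyclicRepresentation hsum⟩, ρ, fun ρ' => ?_,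
    fun x => ?_⟩
  · rw [FilteredFock.isExtendedFreeCreation_iff]
    refine ⟨fun hT => ContinuousLinearMap.ext_on
      (FilteredFock.dense_span_colourVector e d) ?_, fun hT => hT ▸ hL f⟩
    rintro _ ⟨⟨n, g, k⟩, rfl⟩
    exact (hT n g k).trans (hL f n g k).symm
  · refine ⟨fun h => FilteredFock.starAlgHom_generatedAlgebra_ext fun f =>
      (h f).trans (hρ f).symm, fun h => h ▸ hρ⟩
  · obtain ⟨ρx, hρx, U, hU⟩ := FilteredFock.exists_freeFock_representation hiso (hwand x x.2)
      (FilteredFock.norm_of_mem_defectVectors e d x.2)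
    obtain rfl : ρx = ρ := FilteredFock.starAlgHom_generatedAlgebra_ext fun f =>
      (hρx f).trans (hρ f).symm
    exact ⟨U, hU⟩
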